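/- Let $12\le k\le 46$ be an integer and let $f=\sum_{n\ge1}a_n(f)q^n$ ($q=e^{2\pi i\tau}$) be a normalised ($a_1(f)=1$) cuspidal Hecke eigenform of weight $k$ for $\mathrm{SL}_2(\mathbb Z)$, i.e. a cusp form that is an eigenvector of every Hecke operator $T_n$, $n\ge1$. Let $\overline{\mathbb Z}$ be the ring of all algebraic integers. Then for every odd integer $n\ge1$, \[ a_n(f)\equiv\sigma_{k-1}(n)\pmod{128\,\overline{\mathbb Z}}, \qquad\text{where } \sigma_{k-1}(n)=\sum_{d\mid n}d^{k-1}; \] that is, $a_n(f)-\sigma_{k-1}(n)=128\,z$ for some $z\in\overline{\mathbb Z}$. -/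

import Mathlib

open UpperHalfPlane
open scoped MatrixGroups

/-- The `n`-th Hecke operator of level `1` and weight `k`, `n ≥ 1`:
`(T_n f)(τ) = n ^ (k - 1) * ∑_{a d = n} ∑_{0 ≤ b < d} d ^ (-k) * f ((a τ + b) / d)`.
The point `(a τ + b) / d` lies in the upper half plane for every term of the sum, as `a, d > 0`;
`ofComplex` only regards it as an element of `ℍ`. -/
noncomputable def heckeT (k : ℤ) (n : ℕ) (f : ℍ → ℂ) (τ : ℍ) : ℂ :=
  (n : ℂ) ^ (k - 1) * ∑ p ∈ n.divisorsAntidiagonal, ∑ b ∈ Finset.range p.2,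
    (p.2 : ℂ) ^ (-k) * f (ofComplex (((p.1 : ℂ) * (τ : ℂ) + (b : ℂ)) / (p.2 : ℂ)))

/-- The `n`-th coefficient `a_n(f)` of the expansion of a cusp form `f` of level `1`
in powers of `q = exp (2πiτ)`. -/
noncomputable def fourierCoeff1 {k : ℤ} (f : CuspForm 𝒮ℒ k) (n : ℕ) : ℂ :=
  (qExpansion 1 f).coeff n

/-- A cusp form of level `1` and weight `k` is an eigenform if it is normalised (`a_1 = 1`) and is
an eigenvector of all the Hecke operators `T_n`, `n ≥ 1`. -/
structure IsEigenform {k : ℤ} (f : CuspForm 𝒮ℒ k) : Prop where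
  normalised : fourierCoeff1 f 1 = 1
  eigen : ∀ n : ℕ, 1 ≤ n → ∃ c : ℂ, ∀ τ : ℍ, heckeT k n f τ = c * f τ

/-- `x ≡ y` modulo `m ℤ̄`, where `ℤ̄` is the ring of all algebraic integers in `ℂ`. -/
def AlgIntModEq (m : ℕ) (x y : ℂ) : Prop :=
  ∃ z ∈ integralClosure ℤ ℂ, x - y = (m : ℂ) * z

/-! Put F = ∑ σ(n) q^n over odd n. Each series ∑ σ_j(n) q^n over odd n is a multiple of F, and for j
= 3 the quotient is an even series C = 1 + 8W. By Ramanujan's differential equations, E₄, E₆ and Δ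
become polynomials in F and C, with Δ = F (C + 8F)(C − 8F)^4 (`exists_polynomial_expansion`). As F
is odd and C even under q ↦ −q, and 8W is nilpotent modulo 128, the odd parts of all products are
computable: Δ E₄^a E₆^b has the same odd coefficients modulo 128 as the Eisenstein series of its
weight, while those of Δ² E₄^a and Δ² E₄^a E₆ are divisible by 16 and 8 (`coeff_congruences`).

For k ≤ 46 there are at most three cusp forms Δ^(i+1) E₄^(a−3i) E₆^b in the basis of weight k = 12 +
4a + 6b, b ≤ 1. A normalised eigenform has coordinates 1, u x, 128 y with u = 8 if b = 0 and u = 16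
if b = 1. The Hecke relations for a_2², a_2 a_3 and a_3² express x², xy and y² as integral
combinations of 1, x, y, so x and y are algebraic integers (`exists_integral_coordinates`); the
divisibilities behind this are a finite computation. Since 8·16 = 16·8 = 128, only the first basis
element matters at odd n modulo 128. -/

open PowerSeries in
/-- The derivation `q d/dq` on power series. -/
noncomputable def qDeriv (R : Type*) [CommRing R] : Derivation R R⟦X⟧ R⟦X⟧ :=
  (X : R⟦X⟧) • derivative R

/-! ### Parity of divisor sum series, and a linear differential system. -/

namespace EisensteinCongruence

open PowerSeries

lemma coeff_qDeriv {R : Type*} [CommRing R] (f : R⟦X⟧) (n : ℕ) :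
    coeff n (qDeriv R f) = n * coeff n f := by
  cases n with
  | zero => simp [qDeriv]
  | succ n =>
    simp only [qDeriv, Derivation.smul_apply, smul_eq_mul, coeff_succ_X_mul]
    rw [coeff_derivative]
    push_cast
    ring

lemma map_qDeriv {R S : Type*} [CommRing R] [CommRing S] (φ : R →+* S) (f : R⟦X⟧) :
    (qDeriv R f).map φ = qDeriv S (f.map φ) := by
  ext n
  simp [coeff_qDeriv]

lemma evalNegHom_qDeriv {R : Type*} [CommRing R] (f : R⟦X⟧) :
    evalNegHom (qDeriv R f) = qDeriv R (evalNegHom f) := by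
  ext n
  simp only [evalNegHom, coeff_rescale, coeff_qDeriv]
  ring

/-- The generating series of the divisor sums `σ_j(n)`. -/
noncomputable def sigmaSeries (j : ℕ) : ℤ⟦X⟧ := .mk fun n ↦ (ArithmeticFunction.sigma j n : ℤ)

/-- The part of `sigmaSeries j` supported on odd exponents. -/
noncomputable def oddSigma (j : ℕ) : ℤ⟦X⟧ :=
  .mk fun n ↦ if Odd n then (ArithmeticFunction.sigma j n : ℤ) else 0

/-- The part of `sigmaSeries j` supported on even exponents. -/
noncomputable def evenSigma (j : ℕ) : ℤ⟦X⟧ :=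
  .mk fun n ↦ if Odd n then 0 else (ArithmeticFunction.sigma j n : ℤ)

lemma sigmaSeries_eq (j : ℕ) : sigmaSeries j = oddSigma j + evenSigma j := by
  ext n
  simp only [sigmaSeries, oddSigma, evenSigma, coeff_mk, map_add]
  split_ifs <;> simp

lemma evalNegHom_oddSigma (j : ℕ) : evalNegHom (oddSigma j) = -oddSigma j := by
  ext n
  simp only [evalNegHom, coeff_rescale, oddSigma, coeff_mk, map_neg]
  split_ifs with h <;> simp [h]

lemma evalNegHom_evenSigma (j : ℕ) : evalNegHom (evenSigma j) = evenSigma j := by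
  ext n
  simp only [evalNegHom, coeff_rescale, evenSigma, coeff_mk]
  split_ifs with h
  · simp
  · simp [Nat.not_odd_iff_even.mp h]

lemma coeff_odd_eq_zero_of_evalNegHom {f : ℤ⟦X⟧} (hf : evalNegHom f = f) {n : ℕ} (hn : Odd n) :
    coeff n f = 0 := by
  have h := congrArg (coeff n) hf
  simp only [evalNegHom, coeff_rescale, hn.neg_one_pow] at h
  omega

lemma oddSigma_one_ne_zero : oddSigma 1 ≠ 0 := fun h ↦ by
  have := congrArg (coeff 1) h
  simp [oddSigma] at this

/-- `∑ σ(n) q ^ n` over odd `n` is `q` times a unit. -/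
lemma oddSigma_one_dvd {f : ℤ⟦X⟧} (hf : constantCoeff f = 0) : oddSigma 1 ∣ f := by
  obtain ⟨g, rfl⟩ := X_dvd_iff.mpr hf
  obtain ⟨u, hu⟩ : (X : ℤ⟦X⟧) ∣ oddSigma 1 := X_dvd_iff.mpr (by simp [oddSigma])
  have hu1 : constantCoeff u = ((1 : ℤˣ) : ℤ) := by
    have := congrArg (coeff 1) hu
    rw [show (1 : ℕ) = 0 + 1 from rfl, coeff_succ_X_mul] at this
    simpa [oddSigma] using this.symm
  exact ⟨invOfUnit u 1 * g, by
    rw [hu, mul_assoc, ← mul_assoc u, mul_invOfUnit u 1 hu1, one_mul]⟩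

/-- For odd d, 8 divides d³ − d = (d − 1) d (d + 1). This is the source of the 8 in C = 1 + 8W. -/
lemma eight_dvd_oddSigma_sub : ∃ Y : ℤ⟦X⟧, oddSigma 3 - oddSigma 1 = 8 * Y ∧
    constantCoeff Y = 0 := by
  have key (n : ℕ) (hn : Odd n) :
      (8 : ℤ) ∣ ArithmeticFunction.sigma 3 n - ArithmeticFunction.sigma 1 n := by
    simp only [ArithmeticFunction.sigma_apply, Nat.cast_sum, ← Finset.sum_sub_distrib]
    refine Finset.dvd_sum fun d hd ↦ ?_
    obtain ⟨m, rfl⟩ := (Odd.of_dvd_nat hn (Nat.dvd_of_mem_divisors hd))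
    obtain ⟨r, hr⟩ := Nat.even_mul_succ_self m
    have hr' : (m : ℤ) * (m + 1) = r + r := by exact_mod_cast hr
    refine ⟨(2 * m + 1) * r, ?_⟩
    push_cast
    linear_combination 4 * (2 * (m : ℤ) + 1) * hr'
  refine ⟨.mk fun n ↦ if Odd n then
    (ArithmeticFunction.sigma 3 n - ArithmeticFunction.sigma 1 n : ℤ) / 8 else 0, ?_, by simp⟩
  ext n
  rw [show (8 : ℤ⟦X⟧) = C (8 : ℤ) from rfl, coeff_C_mul]
  simp only [oddSigma, coeff_mk, map_sub]
  split_ifs with h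
  · exact (Int.mul_ediv_cancel' (key n h)).symm
  · simp

/-- A power series solution, vanishing to order `2`, of a linear differential system whose leading
matrix has only the eigenvalues `1` and `-1` is zero. -/
lemma eq_zero_of_system {u v w a₁ a₂ b₁ b₂ c₁ c₂ c₃ : ℤ⟦X⟧}
    (hu : 15 * qDeriv ℤ u = a₁ * u - a₂ * v - 5 * w)
    (hv : 210 * qDeriv ℤ v = b₁ * u + b₂ * v + 5 * w)
    (hw : 30 * qDeriv ℤ w = c₁ * u + c₂ * v + c₃ * w)
    (ha₁ : constantCoeff a₁ = 6) (ha₂ : constantCoeff a₂ = 21)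
    (hb₁ : constantCoeff b₁ = 114) (hb₂ : constantCoeff b₂ = -399)
    (hc₁ : constantCoeff c₁ = -27) (hc₂ : constantCoeff c₂ = -63) (hc₃ : constantCoeff c₃ = 15)
    (h0 : ∀ n < 2, coeff n u = 0 ∧ coeff n v = 0 ∧ coeff n w = 0) :
    u = 0 ∧ v = 0 ∧ w = 0 := by
  suffices ∀ n, coeff n u = 0 ∧ coeff n v = 0 ∧ coeff n w = 0 from
    ⟨by ext n; simpa using (this n).1, by ext n; simpa using (this n).2.1,
      by ext n; simpa using (this n).2.2⟩
  intro n
  induction n using Nat.strong_induction_on with | _ n ih =>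
  rcases lt_or_ge n 2 with hn | hn
  · exact h0 n hn
  have hmul (a f : ℤ⟦X⟧) (hf : ∀ m < n, coeff m f = 0) :
      coeff n (a * f) = constantCoeff a * coeff n f := by
    rw [coeff_mul, Finset.sum_eq_single (0, n)]
    · simp
    · rintro ⟨i, j⟩ hij hne
      rw [Finset.HasAntidiagonal.mem_antidiagonal] at hij
      rw [hf j, mul_zero]
      rcases Nat.eq_zero_or_pos i with rfl | hi
      · exact absurd (by simpa using hij) (by simpa using hne)
      · simp only at hij; omega
    · intro h; simp at h
  have hmu (a) := hmul a u fun m hm ↦ (ih m hm).1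
  have hmv (a) := hmul a v fun m hm ↦ (ih m hm).2.1
  have hmw (a) := hmul a w fun m hm ↦ (ih m hm).2.2
  have e1 := congrArg (coeff n) hu
  have e2 := congrArg (coeff n) hv
  have e3 := congrArg (coeff n) hw
  have hnum (m : ℤ) (f : ℤ⟦X⟧) : coeff n ((m : ℤ⟦X⟧) * f) = m * coeff n f := by
    rw [← zsmul_eq_mul, map_zsmul, smul_eq_mul]
  have h15 := hnum 15 (qDeriv ℤ u)
  have h210 := hnum 210 (qDeriv ℤ v)
  have h30 := hnum 30 (qDeriv ℤ w)
  have h5 := hnum 5 w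
  push_cast at h15 h210 h30 h5
  rw [coeff_qDeriv] at h15 h210 h30
  simp only [map_add, map_sub, h15, h210, h30, h5, hmu, hmv, hmw, ha₁, ha₂, hb₁, hb₂, hc₁, hc₂,
    hc₃] at e1 e2 e3
  set x := coeff n u
  set y := coeff n v
  set z := coeff n w
  have hn' : (2 : ℤ) ≤ n := by exact_mod_cast hn
  generalize (n : ℤ) = N at *
  -- The 3 × 3 system at index N has determinant 94500 (N + 1)² (N − 1), and 94500 = 15 · 210 · 30.
  -- The combinations below are the rows of its adjugate.
  have hdet : (N + 1) ^ 2 * (N - 1) ≠ 0 := by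
    have : 0 < (N + 1) ^ 2 * (N - 1) := by apply mul_pos <;> nlinarith
    exact this.ne'
  have hdet' : 94500 * ((N + 1) ^ 2 * (N - 1)) ≠ 0 := mul_ne_zero (by norm_num) hdet
  refine ⟨(mul_eq_zero.mp ?_).resolve_left hdet', (mul_eq_zero.mp ?_).resolve_left hdet',
    (mul_eq_zero.mp ?_).resolve_left hdet'⟩
  · linear_combination ((210 * N + 399) * (30 * N - 15) + 315) * e1
      - (21 * (30 * N - 15) - 315) * e2 + (-105 - 5 * (210 * N + 399)) * e3
  · linear_combination (114 * (30 * N - 15) - 135) * e1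
      + ((15 * N - 6) * (30 * N - 15) - 135) * e2 + (5 * (15 * N - 6) - 570) * e3
  · linear_combination (-7182 - 27 * (210 * N + 399)) * e1
      - (63 * (15 * N - 6) - 567) * e2 + ((15 * N - 6) * (210 * N + 399) + 2394) * e3

end EisensteinCongruence

/-! ### Eisenstein series as polynomials in F and C. -/

namespace EisensteinCongruence

open PowerSeries

/-- The weight `2` Eisenstein series with integral coefficients. -/
noncomputable def eisP : ℤ⟦X⟧ := 1 - 24 * sigmaSeries 1

/-- The weight `4` Eisenstein series with integral coefficients. -/
noncomputable def eisQ : ℤ⟦X⟧ := 1 + 240 * sigmaSeries 3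

/-- The weight `6` Eisenstein series with integral coefficients. -/
noncomputable def eisR : ℤ⟦X⟧ := 1 - 504 * sigmaSeries 5

instance : CharZero ℤ⟦X⟧ := ⟨fun m n h ↦ by
  have := congrArg constantCoeff h
  simpa using this⟩

/-- Ramanujan's differential system. -/
structure RamanujanSystem : Prop where
  derivP : 12 * qDeriv ℤ eisP = eisP ^ 2 - eisQ
  derivQ : 3 * qDeriv ℤ eisQ = eisP * eisQ - eisR
  derivR : 2 * qDeriv ℤ eisR = eisP * eisR - eisQ ^ 2

/-- The Eisenstein series of weights `4` and `6` in terms of `F = ∑ σ(n) q ^ n`, `n` odd, and an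
even series `W`: they become polynomials in the level `4` forms `F` and `C = 1 + 8 W`. -/
theorem exists_level_four_expansion (h : RamanujanSystem) : ∃ W : ℤ⟦X⟧, evalNegHom W = W ∧
    oddSigma 3 = oddSigma 1 * (1 + 8 * W) ∧
    oddSigma 5 = oddSigma 1 * ((1 + 8 * W) ^ 2 + 192 * oddSigma 1 ^ 2) ∧
    1 + 240 * evenSigma 3 = (1 + 8 * W) ^ 2 + 2112 * oddSigma 1 ^ 2 ∧
    1 - 504 * evenSigma 5 = (1 + 8 * W) ^ 3 - 16704 * (1 + 8 * W) * oddSigma 1 ^ 2 := by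
  obtain ⟨Y, hY, hY0⟩ := eight_dvd_oddSigma_sub
  obtain ⟨W, hW⟩ := oddSigma_one_dvd hY0
  obtain ⟨G, hG⟩ : oddSigma 1 ∣ oddSigma 5 := oddSigma_one_dvd (by simp [oddSigma])
  have hF0 := oddSigma_one_ne_zero
  have hX3 : oddSigma 3 = oddSigma 1 * (1 + 8 * W) := by linear_combination hY + 8 * hW
  have hnF : evalNegHom (oddSigma 1) = -oddSigma 1 := evalNegHom_oddSigma 1
  have hFc : constantCoeff (oddSigma 1) = 0 := by simp [oddSigma]
  have hWe : evalNegHom W = W := by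
    have h1 : evalNegHom (oddSigma 3 - oddSigma 1) = -(oddSigma 3 - oddSigma 1) := by
      rw [map_sub, hnF, evalNegHom_oddSigma]; ring
    rw [hY, hW, map_mul, map_mul, hnF, map_ofNat] at h1
    refine mul_left_cancel₀ (mul_ne_zero (by norm_num : (8 : ℤ⟦X⟧) ≠ 0) hF0) ?_
    linear_combination -h1
  have hGe : evalNegHom G = G := by
    have h1 := evalNegHom_oddSigma 5
    rw [hG, map_mul, hnF] at h1
    refine mul_left_cancel₀ hF0 ?_
    linear_combination -h1
  have hCc : constantCoeff (1 + 8 * W) = 1 := by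
    have h1 := congrArg (coeff 1) hX3
    simp [oddSigma, coeff_mul, Finset.Nat.antidiagonal_succ] at h1
    simp [h1]
  have hGc : constantCoeff G = 1 := by
    have h1 := congrArg (coeff 1) hG
    simp [oddSigma, coeff_mul, Finset.Nat.antidiagonal_succ] at h1
    simp [h1]
  have hCe : evalNegHom (1 + 8 * W) = 1 + 8 * W := by simp [hWe, map_ofNat]
  have hpe : evalNegHom (1 - 24 * evenSigma 1) = 1 - 24 * evenSigma 1 := by
    simp [evalNegHom_evenSigma, map_ofNat]
  have hqe : evalNegHom (1 + 240 * evenSigma 3) = 1 + 240 * evenSigma 3 := by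
    simp [evalNegHom_evenSigma, map_ofNat]
  have hre : evalNegHom (1 - 504 * evenSigma 5) = 1 - 504 * evenSigma 5 := by
    simp [evalNegHom_evenSigma, map_ofNat]
  have hpc : constantCoeff (1 - 24 * evenSigma 1) = 1 := by simp [evenSigma]
  have hqc : constantCoeff (1 + 240 * evenSigma 3) = 1 := by simp [evenSigma]
  have hrc : constantCoeff (1 - 504 * evenSigma 5) = 1 := by simp [evenSigma]
  have hP : eisP = (1 - 24 * evenSigma 1) - 24 * oddSigma 1 := by rw [eisP, sigmaSeries_eq]; ring
  have hQ : eisQ = (1 + 240 * evenSigma 3) + 240 * (oddSigma 1 * (1 + 8 * W)) := by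
    rw [eisQ, sigmaSeries_eq, hX3]; ring
  have hR : eisR = (1 - 504 * evenSigma 5) - 504 * (oddSigma 1 * G) := by
    rw [eisR, sigmaSeries_eq, hG]; ring
  refine ⟨W, hWe, hX3, ?_⟩
  rw [hG]
  clear hX3 hG hWe hW hY
  generalize (1 + 8 * W) = C at *
  generalize oddSigma 1 = F at *
  generalize (1 - 24 * evenSigma 1) = p at *
  generalize (1 + 240 * evenSigma 3) = q at *
  generalize (1 - 504 * evenSigma 5) = r at *
  obtain ⟨dP, dQ, dR⟩ := h
  -- The substitution q ↦ −q gives a second copy of the system; sums and differences of the two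
  -- copies separate even and odd parts.
  have nP := congrArg evalNegHom dP
  have nQ := congrArg evalNegHom dQ
  have nR := congrArg evalNegHom dR
  have dnum (n : ℕ) [n.AtLeastTwo] : qDeriv ℤ (OfNat.ofNat n : ℤ⟦X⟧) = 0 :=
    (qDeriv ℤ).map_natCast n
  simp only [hP, hQ, hR, map_mul, map_sub, map_add, map_pow, evalNegHom_qDeriv, map_ofNat, hpe,
    hqe, hre, hnF, hCe, hGe, Derivation.leibniz, Derivation.map_neg, smul_eq_mul, dnum,
    mul_zero, add_zero]
    at dP dQ dR nP nQ nR
  have hDF : 6 * qDeriv ℤ F = F * (p + 5 * C) := by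
    refine mul_left_cancel₀ (by norm_num : (96 : ℤ⟦X⟧) ≠ 0) ?_
    linear_combination nP - dP
  have hDC : 30 * qDeriv ℤ C = 5 * p * C - 25 * C ^ 2 - q + 21 * G := by
    refine mul_left_cancel₀ (mul_ne_zero (by norm_num : (48 : ℤ⟦X⟧) ≠ 0) hF0) ?_
    linear_combination dQ - nQ - 240 * C * hDF
  have hDG : 42 * qDeriv ℤ G = 14 * p * G - 35 * C * G + r + 20 * q * C := by
    refine mul_left_cancel₀ (mul_ne_zero (by norm_num : (48 : ℤ⟦X⟧) ≠ 0) hF0) ?_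
    linear_combination nR - dR - 336 * G * hDF
  have hDq : 3 * qDeriv ℤ q = p * q - 5760 * F ^ 2 * C - r := by
    refine mul_left_cancel₀ (by norm_num : (2 : ℤ⟦X⟧) ≠ 0) ?_
    linear_combination dQ + nQ
  have hDr : 2 * qDeriv ℤ r = p * r + 12096 * F ^ 2 * G - q ^ 2 - 57600 * F ^ 2 * C ^ 2 := by
    refine mul_left_cancel₀ (by norm_num : (2 : ℤ⟦X⟧) ≠ 0) ?_
    linear_combination dR + nR
  clear dP dQ dR nP nQ nR
  -- The system is singular at index 1, so it cannot force the coefficient of q to vanish; evenness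
  -- does.
  have hlead (f : ℤ⟦X⟧) (hf : evalNegHom f = f) (hf0 : constantCoeff f = 0) :
      ∀ n < 2, coeff n f = 0 := by
    intro n hn
    interval_cases n
    · simpa using hf0
    · exact coeff_odd_eq_zero_of_evalNegHom hf odd_one
  -- The constants 2112, 192 and 16704 are those which make the coefficients of q² vanish as well.
  have hu0 := hlead (q - C ^ 2 - 2112 * F ^ 2) (by simp [hqe, hCe, hnF, map_ofNat])
    (by simp [hqc, hCc, hFc])
  have hv0 := hlead (G - C ^ 2 - 192 * F ^ 2) (by simp [hGe, hCe, hnF, map_ofNat])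
    (by simp [hGc, hCc, hFc])
  have hw0 := hlead (r - C ^ 3 + 16704 * C * F ^ 2) (by simp [hre, hCe, hnF, map_ofNat])
    (by simp [hrc, hCc, hFc])
  obtain ⟨hu, hv, hw⟩ := eq_zero_of_system (u := q - C ^ 2 - 2112 * F ^ 2)
    (v := G - C ^ 2 - 192 * F ^ 2) (w := r - C ^ 3 + 16704 * C * F ^ 2)
    (a₁ := 5 * p + C) (a₂ := 21 * C) (b₁ := 114 * C) (b₂ := 70 * p - 469 * C)
    (c₁ := -15 * (q + C ^ 2 + 2112 * F ^ 2) + 3 * C ^ 2 - 16704 * F ^ 2)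
    (c₂ := 181440 * F ^ 2 - 63 * C ^ 2 + 350784 * F ^ 2) (c₃ := 15 * p)
    (by
      simp only [map_sub, Derivation.leibniz, Derivation.leibniz_pow, smul_eq_mul, dnum,
        nsmul_eq_mul]
      push_cast
      linear_combination 5 * hDq - C * hDC - 10560 * F * hDF)
    (by
      simp only [map_sub, Derivation.leibniz, Derivation.leibniz_pow, smul_eq_mul, dnum,
        nsmul_eq_mul]
      push_cast
      linear_combination 5 * hDG - 14 * C * hDC - 13440 * F * hDF)
    (by
      simp only [map_sub, map_add, Derivation.leibniz, Derivation.leibniz_pow, smul_eq_mul, dnum,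
        nsmul_eq_mul]
      push_cast
      linear_combination 15 * hDr - 3 * C ^ 2 * hDC + 16704 * F ^ 2 * hDC
        + 167040 * C * F * hDF)
    (by simp [hpc, hCc, map_ofNat]) (by simp [hCc, map_ofNat]) (by simp [hCc, map_ofNat])
    (by simp [hpc, hCc, map_ofNat]) (by simp [hqc, hCc, hFc, map_ofNat])
    (by simp [hCc, hFc, map_ofNat]) (by simp [hpc, map_ofNat])
    (fun n hn ↦ ⟨hu0 n hn, hv0 n hn, hw0 n hn⟩)
  refine ⟨?_, ?_, ?_⟩
  · linear_combination F * hv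
  · linear_combination hu
  · linear_combination hw

end EisensteinCongruence

/-! ### Congruences modulo 128 for products of Δ, E₄ and E₆. -/

namespace EisensteinCongruence

open PowerSeries

/-- The discriminant with integral coefficients. -/
noncomputable def deltaZ : ℤ⟦X⟧ := .mk fun n ↦ coeff n (eisQ ^ 3 - eisR ^ 2) / 1728

lemma deltaZ_eq_of_mul {Δ : ℤ⟦X⟧} (h : 1728 * Δ = eisQ ^ 3 - eisR ^ 2) : deltaZ = Δ := by
  ext n
  rw [deltaZ, coeff_mk, ← h, show (1728 : ℤ⟦X⟧) = C (1728 : ℤ) from rfl, coeff_C_mul]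
  exact Int.mul_ediv_cancel_left _ (by norm_num)

/-- The Eisenstein series and the discriminant as polynomials in level `4` forms. -/
lemma exists_polynomial_expansion (h : RamanujanSystem) : ∃ W : ℤ⟦X⟧, evalNegHom W = W ∧
    oddSigma 3 = oddSigma 1 * (1 + 8 * W) ∧
    oddSigma 5 = oddSigma 1 * ((1 + 8 * W) ^ 2 + 192 * oddSigma 1 ^ 2) ∧
    eisQ = (1 + 8 * W) ^ 2 + 240 * (oddSigma 1 * (1 + 8 * W)) + 2112 * oddSigma 1 ^ 2 ∧
    eisR = (1 + 8 * W) ^ 3 - 16704 * (1 + 8 * W) * oddSigma 1 ^ 2 -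
      504 * (oddSigma 1 * ((1 + 8 * W) ^ 2 + 192 * oddSigma 1 ^ 2)) ∧
    deltaZ = oddSigma 1 * (1 + 8 * W + 8 * oddSigma 1) * (1 + 8 * W - 8 * oddSigma 1) ^ 4 := by
  obtain ⟨W, hW, h3, h5, hq, hr⟩ := exists_level_four_expansion h
  have hQ : eisQ = (1 + 240 * evenSigma 3) + 240 * oddSigma 3 := by
    rw [eisQ, sigmaSeries_eq]; ring
  have hR : eisR = (1 - 504 * evenSigma 5) - 504 * oddSigma 5 := by
    rw [eisR, sigmaSeries_eq]; ring
  rw [hq, h3] at hQ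
  rw [hr, h5] at hR
  refine ⟨W, hW, h3, h5, by rw [hQ]; ring, hR, deltaZ_eq_of_mul ?_⟩
  rw [hQ, hR]
  ring

/-- The integer division in `deltaZ` is exact, because E₄³ − E₆² is 1728 times an explicit integral
polynomial in F and W. -/
lemma deltaZ_mul (h : RamanujanSystem) : 1728 * deltaZ = eisQ ^ 3 - eisR ^ 2 := by
  obtain ⟨W, -, -, -, hQ, hR, hΔ⟩ := exists_polynomial_expansion h
  rw [hΔ, hQ, hR]
  ring

section Torsion

variable {A : Type*} [CommRing A]

/-- The binomial expansion stops at the square, as (8u)³ = 4 · 128 u³. -/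
lemma one_add_eight_mul_pow (h128 : (128 : A) = 0) (u : A) (m : ℕ) :
    (1 + 8 * u) ^ m = 1 + m * (8 * u) + (m.choose 2 : ℕ) * (8 * u) ^ 2 := by
  induction m with
  | zero => simp
  | succ m ih =>
    rw [pow_succ, ih, Nat.choose_succ_succ' m 1, Nat.choose_one_right]
    push_cast
    linear_combination 4 * u ^ 3 * (m.choose 2 : ℕ) * h128

lemma sixteen_mul_pow (h128 : (128 : A) = 0) (W : A) (j : ℕ) : 16 * (1 + 8 * W) ^ j = 16 := by
  induction j with
  | zero => simp
  | succ j ih => rw [pow_succ]; linear_combination (1 + 8 * W) * ih + W * h128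

/-- The square of 1 + 8W is 1 modulo 16, so even powers disappear next to a factor 8. -/
lemma eight_mul_pow (h128 : (128 : A) = 0) (W : A) (j : ℕ) : 8 * (1 + 8 * W) ^ (2 * j) = 8 := by
  induction j with
  | zero => simp
  | succ j ih =>
    rw [mul_add, pow_add]
    linear_combination (1 + 8 * W) ^ 2 * ih + (W + 4 * W ^ 2) * h128

/-- Modulo 128, Q is C² − 16F + 64F². Its power is linear in a because 16² = 0, and a factor 16
absorbs the powers of C. -/
lemma quartic_pow (h128 : (128 : A) = 0) {Q F W : A}
    (hQ : Q = (1 + 8 * W) ^ 2 + 240 * (F * (1 + 8 * W)) + 2112 * F ^ 2)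
    (a : ℕ) : Q ^ a = (1 + 8 * W) ^ (2 * a) - 16 * a * F + 64 * a * F ^ 2 := by
  have hQ' : Q = (1 + 8 * W) ^ 2 - 16 * F + 64 * F ^ 2 := by
    rw [hQ]; linear_combination (2 * F + 15 * F * W + 16 * F ^ 2) * h128
  induction a with
  | zero => simp
  | succ a ih =>
    have h1 := sixteen_mul_pow h128 W (2 * a)
    have h2 := sixteen_mul_pow h128 W 2
    rw [pow_succ, ih, hQ', mul_add 2, pow_add]
    push_cast
    generalize (1 + 8 * W) ^ (2 * a) = E at *
    linear_combination (-F + 4 * F ^ 2) * h1 + (-a * F + 4 * a * F ^ 2) * h2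
      + (2 * a * F ^ 2 - 16 * a * F ^ 3 + 32 * a * F ^ 4) * h128

lemma delta_eq (h128 : (128 : A) = 0) (F W : A) : F * (1 + 8 * W + 8 * F) * (1 + 8 * W - 8 * F) ^ 4
    = F * (1 + 8 * W) ^ 5 - 24 * F ^ 2 := by
  have h1 := eight_mul_pow h128 W 2
  generalize 1 + 8 * W = C at *
  linear_combination -3 * F ^ 2 * h1
    + (F ^ 3 * C ^ 3 + 8 * F ^ 4 * C ^ 2 - 96 * F ^ 5 * C + 256 * F ^ 6) * h128

lemma sextic_eq (h128 : (128 : A) = 0) (F W : A) : (1 + 8 * W) ^ 3 - 16704 * (1 + 8 * W) * F ^ 2 -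
    504 * (F * ((1 + 8 * W) ^ 2 + 192 * F ^ 2)) = (1 + 8 * W) ^ 3 + 8 * F + 64 * F ^ 2 := by
  have h1 := eight_mul_pow h128 W 1
  have h2 := sixteen_mul_pow h128 W 1
  rw [pow_one] at h2
  generalize 1 + 8 * W = C at *
  linear_combination F * h1 + 4 * F ^ 2 * h2 +
    (-4 * F * C ^ 2 - 131 * F ^ 2 * C - 756 * F ^ 3) * h128

/-- The product `Δ Q ^ a R ^ b`, `b ≤ 1`, in a ring in which `128 = 0`. -/
lemma delta_mul_eq (h128 : (128 : A) = 0) {Q R Δ F W : A}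
    (hQ : Q = (1 + 8 * W) ^ 2 + 240 * (F * (1 + 8 * W)) + 2112 * F ^ 2)
    (hR : R = (1 + 8 * W) ^ 3 - 16704 * (1 + 8 * W) * F ^ 2 -
      504 * (F * ((1 + 8 * W) ^ 2 + 192 * F ^ 2)))
    (hΔ : Δ = F * (1 + 8 * W + 8 * F) * (1 + 8 * W - 8 * F) ^ 4) (a : ℕ) :
    Δ * Q ^ a = F * (1 + 8 * W) ^ (5 + 2 * a) + 64 * a * F ^ 3 + (-(16 * a + 24) * F ^ 2) ∧
    Δ * Q ^ a * R = F * (1 + 8 * W) ^ (8 + 2 * a) + 64 * a * F ^ 3 +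
      (8 * F ^ 2 * (1 + 8 * W) ^ (5 + 2 * a) - (16 * a + 24) * F ^ 2 * (1 + 8 * W) ^ 3) := by
  -- In both formulas the final bracket is even when F is odd and W is even, while the terms before
  -- it are odd.
  have h1 : Δ * Q ^ a =
      F * (1 + 8 * W) ^ (5 + 2 * a) + 64 * a * F ^ 3 + (-(16 * a + 24) * F ^ 2) := by
    have h1 := sixteen_mul_pow h128 W 5
    have h2 := eight_mul_pow h128 W a
    rw [hΔ, delta_eq h128, quartic_pow h128 hQ, pow_add]
    generalize (1 + 8 * W) ^ (2 * a) = E at *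
    generalize (1 + 8 * W) ^ 5 = E' at *
    linear_combination (-a * F ^ 2 + 4 * a * F ^ 3) * h1 - 3 * F ^ 2 * h2 +
      (3 * a * F ^ 3 - 12 * a * F ^ 4) * h128
  refine ⟨h1, ?_⟩
  have h2 := sixteen_mul_pow h128 W 3
  have h3 := sixteen_mul_pow h128 W (5 + 2 * a)
  rw [h1, hR, sextic_eq h128, show 8 + 2 * a = 5 + 2 * a + 3 by ring, pow_add _ (5 + 2 * a)]
  generalize (1 + 8 * W) ^ (5 + 2 * a) = E at *
  generalize (1 + 8 * W) ^ 3 = E' at *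
  linear_combination 4 * F ^ 3 * h3 + 4 * a * F ^ 3 * h2 +
    (-a * F ^ 3 - F ^ 3 - 4 * a * F ^ 4 - 12 * F ^ 4 + 32 * a * F ^ 5) * h128

/-- Multiples of `Δ ^ 2 Q ^ a R ^ b`, `b ≤ 1`, in a ring in which `128 = 0`. -/
lemma mul_delta_sq_eq (h128 : (128 : A) = 0) {Q R Δ F W : A}
    (hQ : Q = (1 + 8 * W) ^ 2 + 240 * (F * (1 + 8 * W)) + 2112 * F ^ 2)
    (hR : R = (1 + 8 * W) ^ 3 - 16704 * (1 + 8 * W) * F ^ 2 -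
      504 * (F * ((1 + 8 * W) ^ 2 + 192 * F ^ 2)))
    (hΔ : Δ = F * (1 + 8 * W + 8 * F) * (1 + 8 * W - 8 * F) ^ 4) (a : ℕ) :
    8 * (Δ ^ 2 * Q ^ a) = 8 * F ^ 2 ∧ 16 * (Δ ^ 2 * Q ^ a * R) = 16 * F ^ 2 := by
  have h1 : 8 * (Δ ^ 2 * Q ^ a) = 8 * F ^ 2 := by
    have h1 := eight_mul_pow h128 W 5
    have h2 := eight_mul_pow h128 W a
    rw [hΔ, delta_eq h128, quartic_pow h128 hQ]
    generalize (1 + 8 * W) ^ (2 * a) = E at *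
    rw [show (1 + 8 * W) ^ (2 * 5) = ((1 + 8 * W) ^ 5) ^ 2 by ring] at h1
    generalize (1 + 8 * W) ^ 5 = E' at *
    linear_combination E * F ^ 2 * h1 + F ^ 2 * h2 + ((F * E' - 24 * F ^ 2) ^ 2 *
      (-a * F + 4 * a * F ^ 2) + E * (-3 * F ^ 3 * E' + 36 * F ^ 4)) * h128
  refine ⟨h1, ?_⟩
  have h2 := sixteen_mul_pow h128 W 3
  rw [hR, sextic_eq h128]
  generalize (1 + 8 * W) ^ 3 = E' at *
  linear_combination 2 * (E' + 8 * F + 64 * F ^ 2) * h1 + F ^ 2 * h2 +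
    (F ^ 3 + 8 * F ^ 4) * h128

end Torsion

/-- Divisor sums of odd numbers modulo `128`. -/
lemma sigma_odd_cast {n : ℕ} (hn : Odd n) (m : ℕ) :
    (ArithmeticFunction.sigma (2 * m + 1) n : ZMod 128) = ArithmeticFunction.sigma 1 n +
      m * (ArithmeticFunction.sigma 3 n - ArithmeticFunction.sigma 1 n) +
      (m.choose 2 : ℕ) * (ArithmeticFunction.sigma 5 n - 2 * ArithmeticFunction.sigma 3 n +
        ArithmeticFunction.sigma 1 n) := by
  simp only [ArithmeticFunction.sigma_apply, Nat.cast_sum, Nat.cast_pow]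
  simp only [Finset.mul_sum, ← Finset.sum_sub_distrib, ← Finset.sum_add_distrib]
  refine Finset.sum_congr rfl fun d hd ↦ ?_
  obtain ⟨t, rfl⟩ := (Odd.of_dvd_nat hn (Nat.dvd_of_mem_divisors hd))
  obtain ⟨r, hr⟩ := Nat.even_mul_succ_self t
  have hr' : (t : ZMod 128) * (t + 1) = r + r := by
    exact_mod_cast congrArg (Nat.cast (R := ZMod 128)) hr
  -- With d² = 1 + 8r, the power d^(2m+1) is d times a quadratic polynomial in m; the formula is
  -- Newton interpolation from m = 0, 1, 2.
  have hd : ((2 * t + 1 : ℕ) : ZMod 128) ^ 2 = 1 + 8 * r := by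
    push_cast
    linear_combination 4 * hr'
  have hp := one_add_eight_mul_pow (by decide) (r : ZMod 128) m
  generalize ((2 * t + 1 : ℕ) : ZMod 128) = d at hd
  rw [pow_succ, pow_mul, hd, hp, show d ^ 3 = (1 + 8 * r) * d by rw [← hd]; ring,
    show d ^ 5 = (1 + 8 * r) ^ 2 * d by rw [← hd]; ring]
  ring

/-- The odd part of the generating series of `σ_{2m+1}`, modulo `128`. -/
lemma map_oddSigma {W : ℤ⟦X⟧} (h3 : oddSigma 3 = oddSigma 1 * (1 + 8 * W))
    (h5 : oddSigma 5 = oddSigma 1 * ((1 + 8 * W) ^ 2 + 192 * oddSigma 1 ^ 2)) (m : ℕ) :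
    (oddSigma (2 * m + 1)).map (Int.castRingHom (ZMod 128)) =
      (oddSigma 1 * (1 + 8 * W) ^ m + 64 * (m.choose 2 : ℤ⟦X⟧) * oddSigma 1 ^ 3).map
        (Int.castRingHom (ZMod 128)) := by
  have hz : (128 : ZMod 128) = 0 := by decide
  have hA : (128 : (ZMod 128)⟦X⟧) = 0 := by
    rw [show (128 : (ZMod 128)⟦X⟧) = C (128 : ZMod 128) from rfl, hz, map_zero]
  have key : (oddSigma (2 * m + 1)).map (Int.castRingHom (ZMod 128)) =
      (oddSigma 1 + (m : ℤ⟦X⟧) * (oddSigma 3 - oddSigma 1) +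
        (m.choose 2 : ℤ⟦X⟧) * (oddSigma 5 - 2 * oddSigma 3 + oddSigma 1)).map
        (Int.castRingHom (ZMod 128)) := by
    ext n
    rw [show (2 : ℤ⟦X⟧) = ((2 : ℕ) : ℤ⟦X⟧) from rfl]
    simp only [coeff_map, map_add, map_sub, ← nsmul_eq_mul, map_nsmul, oddSigma, coeff_mk]
    split_ifs with hn
    · simpa [mul_add] using sigma_odd_cast hn m
    · simp
  rw [key, h3, h5]
  simp only [map_add, map_sub, map_mul, map_pow, map_ofNat, map_natCast, map_one,
    one_add_eight_mul_pow hA _ m]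
  linear_combination (m.choose 2 : (ZMod 128)⟦X⟧) *
    (map (Int.castRingHom (ZMod 128))) (oddSigma 1) ^ 3 * hA

lemma coeff_eq_of_map_eq {f g E : ℤ⟦X⟧} {N : ℕ}
    (h : f.map (Int.castRingHom (ZMod N)) = (g + E).map (Int.castRingHom (ZMod N)))
    (hE : evalNegHom E = E) {n : ℕ} (hn : Odd n) : (N : ℤ) ∣ coeff n f - coeff n g := by
  have h1 := congrArg (coeff n) h
  rw [coeff_map, coeff_map, map_add, coeff_odd_eq_zero_of_evalNegHom hE hn, add_zero] at h1
  rw [← ZMod.intCast_zmod_eq_zero_iff_dvd]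
  simpa [sub_eq_zero] using h1

/-- The exponents m = 5 + 2a and m = 8 + 2a satisfy 2m + 1 = k − 1 for b = 0 and b = 1. Next to 64
only the parity of the binomial coefficient counts, and it is that of a. -/
lemma choose_two_cast {A : Type*} [CommRing A] (h128 : (128 : A) = 0) (a : ℕ) :
    (64 : A) * ((5 + 2 * a).choose 2 : ℕ) = 64 * a ∧
      (64 : A) * ((8 + 2 * a).choose 2 : ℕ) = 64 * a := by
  have h1 (n : ℕ) : 2 * n.choose 2 = n * (n - 1) := by
    rw [Nat.choose_two_right, Nat.mul_div_cancel' (Nat.even_mul_pred_self n).two_dvd]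
  constructor
  · have h2 : (5 + 2 * a).choose 2 = a + 2 * (a ^ 2 + 4 * a + 5) := by
      have := h1 (5 + 2 * a)
      rw [show 5 + 2 * a - 1 = 4 + 2 * a by omega] at this
      linarith
    rw [h2]
    push_cast
    linear_combination ((a : A) ^ 2 + 4 * a + 5) * h128
  · have h2 : (8 + 2 * a).choose 2 = a + 2 * (a ^ 2 + 7 * a + 14) := by
      have := h1 (8 + 2 * a)
      rw [show 8 + 2 * a - 1 = 7 + 2 * a by omega] at this
      linarith
    rw [h2]
    push_cast
    linear_combination ((a : A) ^ 2 + 7 * a + 14) * h128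

/-- For odd `n`, the coefficients of `Δ Q ^ a R ^ b`, `b ≤ 1`, agree with those of the Eisenstein
series of the same weight modulo `128`, and those of `Δ ^ 2 Q ^ a` and `Δ ^ 2 Q ^ a R` vanish
modulo `16` and `8`. -/
theorem coeff_congruences (h : RamanujanSystem) (a : ℕ) {n : ℕ} (hn : Odd n) :
    (128 : ℤ) ∣ coeff n (deltaZ * eisQ ^ a) - ArithmeticFunction.sigma (11 + 4 * a) n ∧
    (128 : ℤ) ∣ coeff n (deltaZ * eisQ ^ a * eisR) - ArithmeticFunction.sigma (17 + 4 * a) n ∧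
    (16 : ℤ) ∣ coeff n (deltaZ ^ 2 * eisQ ^ a) ∧
    (8 : ℤ) ∣ coeff n (deltaZ ^ 2 * eisQ ^ a * eisR) := by
  obtain ⟨W, hW, h3, h5, hQ, hR, hΔ⟩ := exists_polynomial_expansion h
  have hA : (128 : (ZMod 128)⟦X⟧) = 0 := by
    rw [show (128 : (ZMod 128)⟦X⟧) = C (128 : ZMod 128) from rfl, show (128 : ZMod 128) = 0 from rfl,
      map_zero]
  have hF := evalNegHom_oddSigma 1
  have hσ (j : ℕ) : (ArithmeticFunction.sigma j n : ℤ) = coeff n (oddSigma j) := by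
    simp [oddSigma, hn]
  have mQ := congrArg (map (Int.castRingHom (ZMod 128))) hQ
  have mR := congrArg (map (Int.castRingHom (ZMod 128))) hR
  have mΔ := congrArg (map (Int.castRingHom (ZMod 128))) hΔ
  simp only [map_add, map_sub, map_mul, map_pow, map_ofNat, map_one] at mQ mR mΔ
  obtain ⟨e1, e2⟩ := delta_mul_eq hA mQ mR mΔ a
  obtain ⟨e3, e4⟩ := mul_delta_sq_eq hA mQ mR mΔ a
  obtain ⟨c1, c2⟩ := choose_two_cast hA a
  rw [hσ, hσ, show 11 + 4 * a = 2 * (5 + 2 * a) + 1 by ring,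
    show 17 + 4 * a = 2 * (8 + 2 * a) + 1 by ring]
  refine ⟨?_, ?_, ?_, ?_⟩
  · refine coeff_eq_of_map_eq (N := 128) (E := -(16 * (a : ℤ⟦X⟧) + 24) * oddSigma 1 ^ 2) ?_ ?_ hn
    · rw [map_add, map_oddSigma h3 h5]
      simp only [map_add, map_mul, map_pow, map_neg, map_ofNat, map_one, map_natCast]
      rw [e1, c1]
    · simp [hF, map_ofNat]
  · refine coeff_eq_of_map_eq (N := 128) (E := 8 * oddSigma 1 ^ 2 * (1 + 8 * W) ^ (5 + 2 * a) -
      (16 * (a : ℤ⟦X⟧) + 24) * oddSigma 1 ^ 2 * (1 + 8 * W) ^ 3) ?_ ?_ hn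
    · rw [map_add, map_oddSigma h3 h5]
      simp only [map_add, map_sub, map_mul, map_pow, map_ofNat, map_one, map_natCast]
      rw [e2, c2]
    · simp [hF, hW, map_ofNat]
  -- Modulo 128 the multiple by 8 is the even series 8F²; cancelling 8 leaves divisibility by 16.
  · have := coeff_eq_of_map_eq (N := 128) (f := 8 * (deltaZ ^ 2 * eisQ ^ a)) (g := 0)
      (E := 8 * oddSigma 1 ^ 2) (by
        simp only [zero_add, map_mul, map_pow, map_ofNat]
        exact e3) (by simp [hF, map_ofNat]) hn
    rw [show (8 : ℤ⟦X⟧) = C (8 : ℤ) from rfl, coeff_C_mul] at this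
    simp only [map_zero] at this
    push_cast at this
    omega
  · have := coeff_eq_of_map_eq (N := 128) (f := 16 * (deltaZ ^ 2 * eisQ ^ a * eisR)) (g := 0)
      (E := 16 * oddSigma 1 ^ 2) (by
        simp only [zero_add, map_mul, map_pow, map_ofNat]
        exact e4) (by simp [hF, map_ofNat]) hn
    rw [show (16 : ℤ⟦X⟧) = C (16 : ℤ) from rfl, coeff_C_mul] at this
    simp only [map_zero] at this
    push_cast at this
    omega

end EisensteinCongruence

/-! ### Calculus of convergent q-series. -/

namespace EisensteinCongruence

open PowerSeries ModularForm EisensteinSeries Derivative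
open scoped Manifold Real

/-- `f` is given on the upper half plane by the convergent power series `p` in `q`. -/
def HasQSeries (f : ℍ → ℂ) (p : ℂ⟦X⟧) : Prop :=
  ∀ τ : ℍ, HasSum (fun m ↦ coeff m p • Function.Periodic.qParam 1 τ ^ m) (f τ)

namespace HasQSeries

variable {f g : ℍ → ℂ} {p r : ℂ⟦X⟧}

lemma qParam_surj {q : ℂ} (hq : ‖q‖ < 1) (hq0 : q ≠ 0) :
    ∃ τ : ℍ, Function.Periodic.qParam 1 τ = q :=
  ⟨⟨_, Function.Periodic.im_invQParam_pos_of_norm_lt_one one_pos hq hq0⟩,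
    Function.Periodic.qParam_right_inv one_ne_zero hq0⟩

lemma add (hf : HasQSeries f p) (hg : HasQSeries g r) : HasQSeries (f + g) (p + r) := fun τ ↦ by
  simpa [add_mul] using (hf τ).add (hg τ)

lemma smul (hf : HasQSeries f p) (c : ℂ) : HasQSeries (c • f) (c • p) := fun τ ↦ by
  simpa [mul_assoc] using (hf τ).mul_left c

lemma neg (hf : HasQSeries f p) : HasQSeries (-f) (-p) := by simpa using hf.smul (-1)

lemma sub (hf : HasQSeries f p) (hg : HasQSeries g r) : HasQSeries (f - g) (p - r) := by
  simpa [sub_eq_add_neg] using hf.add hg.neg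

lemma isBounded (hf : HasQSeries f p) : IsBoundedAtImInfty f :=
  isBoundedAtImInfty_of_hasSum_qExpansion one_pos hf

/-- Comparison with a point τ whose parameter is a real s with ‖q‖ < s < 1; this also covers q = 0,
which no τ attains. -/
lemma summable_norm (hf : HasQSeries f p) {q : ℂ} (hq : ‖q‖ < 1) :
    Summable fun m ↦ ‖coeff m p * q ^ m‖ := by
  obtain ⟨s, hs1, hs2⟩ := exists_between hq
  have hs0 : 0 < s := (norm_nonneg q).trans_lt hs1
  obtain ⟨τ, hτ⟩ := qParam_surj (q := (s : ℂ)) (by simpa [abs_of_pos hs0] using hs2)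
    (by exact_mod_cast hs0.ne')
  have h := (hf τ).summable.norm
  rw [hτ] at h
  refine h.of_nonneg_of_le (fun _ ↦ norm_nonneg _) fun m ↦ ?_
  simp only [norm_mul, norm_pow, smul_eq_mul, Complex.norm_real, Real.norm_eq_abs, abs_of_pos hs0]
  gcongr

lemma mul (hf : HasQSeries f p) (hg : HasQSeries g r) : HasQSeries (f * g) (p * r) := fun τ ↦ by
  have hq : ‖Function.Periodic.qParam 1 τ‖ < 1 := Function.Periodic.norm_qParam_lt_one one_pos τ.im_pos
  have h1 := hf.summable_norm hq
  have h2 := hg.summable_norm hq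
  have h := summable_norm_sum_mul_antidiagonal_of_summable_norm h1 h2
  have h' := tsum_mul_tsum_eq_tsum_sum_antidiagonal_of_summable_norm h1 h2
  have e1 : ∑' n, coeff n p * Function.Periodic.qParam 1 τ ^ n = f τ := (hf τ).tsum_eq
  have e2 : ∑' n, coeff n r * Function.Periodic.qParam 1 τ ^ n = g τ := (hg τ).tsum_eq
  rw [e1, e2] at h'
  rw [Pi.mul_apply, h']
  convert! h.of_norm.hasSum using 2 with n
  rw [coeff_mul, smul_eq_mul, Finset.sum_mul]
  refine Finset.sum_congr rfl fun x hx ↦ ?_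
  rw [← Finset.HasAntidiagonal.mem_antidiagonal.mp hx, pow_add]
  ring

lemma hasFPowerSeries (hf : HasQSeries f p) :
    HasFPowerSeriesOnBall (fun q ↦ ∑' m, coeff m p * q ^ m)
      (.ofScalars ℂ fun m ↦ coeff m p) 0 1 := by
  refine ⟨?_, by simp, fun {y} hy ↦ ?_⟩
  · refine le_of_forall_lt_imp_le_of_dense fun r hr ↦ ?_
    lift r to NNReal using hr.ne_top
    apply FormalMultilinearSeries.le_radius_of_summable
    simpa [FormalMultilinearSeries.ofScalars_norm] using
      hf.summable_norm (q := ((r : ℝ) : ℂ)) (by simpa using hr)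
  · have hy' : ‖y‖ < 1 := by
      rw [← ENNReal.coe_one, Metric.eball_coe, NNReal.coe_one, mem_ball_zero_iff] at hy
      exact hy
    simpa [mul_comm] using (hf.summable_norm hy').of_norm.hasSum

/-- The two sums agree on the punctured disc, hence at 0 by continuity, and a power series is
determined by its sum. -/
lemma unique (hf : HasQSeries f p) (hg : HasQSeries f r) : p = r := by
  have h : (fun q ↦ ∑' m, coeff m p * q ^ m) =ᶠ[nhds 0] fun q ↦ ∑' m, coeff m r * q ^ m := by
    have hc1 := hf.hasFPowerSeries.hasFPowerSeriesAt.continuousAt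
    have hc2 := hg.hasFPowerSeries.hasFPowerSeriesAt.continuousAt
    refine (hc1.eventuallyEq_nhds_iff_eventuallyEq_nhdsNE hc2).mp ?_
    filter_upwards [self_mem_nhdsWithin,
      mem_nhdsWithin_of_mem_nhds (Metric.ball_mem_nhds 0 one_pos)] with q hq0 hq
    obtain ⟨τ, rfl⟩ := qParam_surj (by simpa using hq) hq0
    exact (hf τ).tsum_eq.trans (hg τ).tsum_eq.symm
  have h2 := hf.hasFPowerSeries.hasFPowerSeriesAt.eq_formalMultilinearSeries
    (hg.hasFPowerSeries.hasFPowerSeriesAt.congr h.symm)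
  ext n
  simpa using congrArg (FormalMultilinearSeries.coeff · n) h2

/-- The chain rule with dq/dτ = 2πi q turns (2πi)⁻¹ d/dτ into q d/dq. -/
lemma deriv (hf : HasQSeries f p) : HasQSeries (D f) (qDeriv ℂ p) := fun τ ↦ by
  have hq : ‖Function.Periodic.qParam 1 τ‖ < 1 := Function.Periodic.norm_qParam_lt_one one_pos τ.im_pos
  set g : ℂ → ℂ := fun q ↦ ∑' m, coeff m p * q ^ m with hg
  have hs := hf.hasFPowerSeries
  set q := Function.Periodic.qParam 1 τ with hqdef
  have hqm : q ∈ Metric.eball (0 : ℂ) 1 := by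
    rw [← ENNReal.coe_one, Metric.eball_coe, NNReal.coe_one, mem_ball_zero_iff]
    exact hq
  have hdiff : HasDerivAt g (_root_.deriv g q) q := (hs.analyticAt_of_mem hqm).differentiableAt.hasDerivAt
  have hcomp : HasDerivAt (f ∘ ofComplex) (_root_.deriv g q * (2 * (π : ℂ) * Complex.I * q)) τ := by
    have h1 : HasDerivAt (Function.Periodic.qParam 1) (2 * (π : ℂ) * Complex.I * q) τ := by
      have h2 := (((hasDerivAt_id (τ : ℂ)).const_mul (2 * (π : ℂ) * Complex.I)).div_const
        ((1 : ℝ) : ℂ)).cexp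
      refine h2.congr_deriv ?_
      simp [hqdef, Function.Periodic.qParam]
      ring
    refine (hdiff.comp (τ : ℂ) h1).congr_of_eventuallyEq ?_
    filter_upwards [isOpen_upperHalfPlaneSet.mem_nhds τ.im_pos] with w hw
    rw [Function.comp_apply, ofComplex_apply_of_im_pos hw]
    exact (hf ⟨w, hw⟩).tsum_eq.symm
  have hD : D f τ = q * _root_.deriv g q := by
    rw [normalizedDerivOfComplex, hcomp.deriv]
    field
  have hsum : HasSum (fun n ↦ ((n + 1 : ℕ) * coeff (n + 1) p) * q ^ n) (_root_.deriv g q) := by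
    have h1 := hs.fderiv.hasSum hqm
    have h2 := (ContinuousLinearMap.apply ℂ ℂ (1 : ℂ)).hasSum h1
    simp only [zero_add, ContinuousLinearMap.apply_apply, fderiv_apply_one_eq_deriv] at h2
    refine h2.congr_fun fun n ↦ ?_
    simp only [FormalMultilinearSeries.apply_eq_pow_smul_coeff,
      smul_apply, FormalMultilinearSeries.derivSeries_coeff_one,
      FormalMultilinearSeries.coeff_ofScalars]
    simp
    ring
  rw [hD]
  refine (hasSum_nat_add_iff' 1).mp ?_
  simp [coeff_qDeriv]
  convert! hsum.mul_left q using 2 with n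
  push_cast
  ring

end HasQSeries

end EisensteinCongruence

/-! ### Ramanujan's identities. -/

namespace EisensteinCongruence

open PowerSeries ModularForm EisensteinSeries Derivative
open scoped Manifold Real

lemma hasQSeries_modularForm {k : ℤ} {F : Type*} [FunLike F ℍ ℂ] [ModularFormClass F 𝒮ℒ k] (f : F) :
    HasQSeries f (qExpansion 1 f) := fun τ ↦
  τ.hasSum_qExpansion one_pos
    (SlashInvariantFormClass.periodic_comp_ofComplex f one_mem_strictPeriods_SL)
    (ModularFormClass.holo f) (ModularFormClass.bdd_at_infty f)

/-- A holomorphic function that is modular of weight `k < 12` and has a `q`-series without constant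
term has zero `q`-series. -/
lemma qSeries_eq_zero_of_weight_lt {k : ℕ} (hk : k < 12) {g : ℍ → ℂ} {p : ℂ⟦X⟧} (hg : MDiff g)
    (hinv : ∀ γ : SL(2, ℤ), g ∣[(k : ℤ)] γ = g) (hp : HasQSeries g p) (h0 : coeff 0 p = 0) :
    p = 0 := by
  let G : ModularForm 𝒮ℒ (k : ℤ) :=
    { toFun := g
      slash_action_eq' := fun _ ⟨γ, hγ⟩ ↦ hγ ▸ hinv γ
      holo' := hg
      bdd_at_cusps' := fun {c} hc ↦ by
        rw [Subgroup.IsArithmetic.isCusp_iff_isCusp_SL2Z] at hc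
        rw [OnePoint.isBoundedAt_iff_forall_SL2Z hc]
        intro γ _
        rw [hinv γ]
        exact hp.isBounded }
  have hG : qExpansion 1 G = p := (hasQSeries_modularForm G).unique hp
  have hG0 : G = 0 := by
    refine ModularForm.sturm_bound_levelOne_nat ?_
    -- The Sturm bound is ⌊k/12⌋ = 0, so a vanishing constant term suffices.
    rw [Nat.div_eq_of_lt hk, hG]
    refine lt_of_lt_of_le (by norm_num) (PowerSeries.nat_le_order p 1 fun i hi ↦ ?_)
    rw [show i = 0 by simpa using hi, h0]
  rw [← hG, hG0]
  exact qExpansion_zero 1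

/-- The `q`-series with integral coefficients as a series with complex coefficients. -/
noncomputable abbrev toC : ℤ⟦X⟧ →+* ℂ⟦X⟧ := PowerSeries.map (Int.castRingHom ℂ)

lemma toC_injective : Function.Injective toC :=
  PowerSeries.map_injective _ Int.cast_injective

lemma qExpansion_E₄ : qExpansion 1 E₄ = toC eisQ := by
  ext n
  rw [E_qExpansion_coeff _ ⟨2, rfl⟩, show bernoulli 4 = -1 / 30 by decide +kernel, eisQ,
    show (240 : ℤ⟦X⟧) = C (240 : ℤ) from rfl]
  simp only [coeff_map, map_add, coeff_one, coeff_C_mul, sigmaSeries, coeff_mk]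
  split_ifs with h
  · simp [h]
  · norm_num

lemma qExpansion_E₆ : qExpansion 1 E₆ = toC eisR := by
  ext n
  rw [E_qExpansion_coeff _ ⟨3, rfl⟩, show bernoulli 6 = 1 / 42 by decide +kernel, eisR,
    show (504 : ℤ⟦X⟧) = C (504 : ℤ) from rfl]
  simp only [coeff_map, map_sub, coeff_one, coeff_C_mul, sigmaSeries, coeff_mk]
  split_ifs with h
  · simp [h]
  · norm_num

lemma hasQSeries_E₄ : HasQSeries E₄ (toC eisQ) := qExpansion_E₄ ▸ hasQSeries_modularForm E₄

lemma hasQSeries_E₆ : HasQSeries E₆ (toC eisR) := qExpansion_E₆ ▸ hasQSeries_modularForm E₆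

lemma hasQSeries_E2 : HasQSeries E2 (toC eisP) := fun τ ↦ by
  convert! hasSum_qExpansion_E2 τ using 2 with n
  rw [eisP, show (24 : ℤ⟦X⟧) = C (24 : ℤ) from rfl]
  simp only [coeff_map, map_sub, coeff_one, coeff_C_mul, sigmaSeries, coeff_mk,
    Function.Periodic.qParam]
  split_ifs with h
  · simp [h]
  · simp

lemma slash_eq_of_modularForm {k : ℤ} (f : ModularForm 𝒮ℒ k) (γ : SL(2, ℤ)) :
    (f : ℍ → ℂ) ∣[k] γ = f :=
  f.slash_action_eq' γ ⟨γ, rfl⟩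

lemma hasQSeries_serreDerivative {f : ℍ → ℂ} {p : ℂ⟦X⟧} (hf : HasQSeries f p) (k : ℂ) :
    HasQSeries (serreDerivative k f) (qDeriv ℂ p - (k * 12⁻¹) • (toC eisP * p)) := by
  convert! hf.deriv.sub ((hasQSeries_E2.mul hf).smul (k * 12⁻¹)) using 1
  ext z
  simp [serreDerivative_apply, mul_assoc]

lemma constantCoeff_toC_eis : constantCoeff (toC eisP) = 1 ∧ constantCoeff (toC eisQ) = 1 ∧
    constantCoeff (toC eisR) = 1 := by
  have h (j : ℕ) : constantCoeff (toC (sigmaSeries j)) = 0 := by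
    rw [← coeff_zero_eq_constantCoeff_apply, coeff_map]
    simp [sigmaSeries]
  simp [eisP, eisQ, eisR, h]

lemma natCast_mul_one_div_smul {n : ℕ} (hn : n ≠ 0) (f : ℂ⟦X⟧) :
    (n : ℂ⟦X⟧) * ((1 / n : ℂ) • f) = f := by
  rw [← nsmul_eq_mul, ← Nat.cast_smul_eq_nsmul ℂ, smul_smul, mul_one_div_cancel (by simpa using hn),
    one_smul]

/-- The Serre derivative of E₄ plus E₆/3 is modular of weight 6, with constant term −4/12 + 1/3 = 0.
-/
lemma ramanujan_Q : 3 * qDeriv ℤ eisQ = eisP * eisQ - eisR := by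
  have h := qSeries_eq_zero_of_weight_lt (k := 6) (by norm_num)
    (g := serreDerivative ((4 : ℤ) : ℂ) E₄ + (3⁻¹ : ℂ) • (E₆ : ℍ → ℂ))
    ((serreDerivative_mdifferentiable _ (ModularFormClass.holo E₄)).add
      ((ModularFormClass.holo E₆).const_smul _))
    (fun γ ↦ by
      have h1 := serreDerivative_slash_invariant (ModularFormClass.holo E₄)
        (slash_eq_of_modularForm E₄ γ)
      have h2 := slash_eq_of_modularForm E₆ γ
      norm_num at h1 h2 ⊢
      rw [h2, h1])
    ((hasQSeries_serreDerivative hasQSeries_E₄ _).add (hasQSeries_E₆.smul _))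
    (by
      obtain ⟨h1, h2, h3⟩ := constantCoeff_toC_eis
      simp only [map_add, map_sub, coeff_qDeriv, PowerSeries.coeff_smul,
        coeff_zero_eq_constantCoeff_apply, map_mul, h1, h2, h3]
      norm_num)
  have e1 := natCast_mul_one_div_smul (n := 3) (by norm_num) (toC eisP * toC eisQ)
  have e2 := natCast_mul_one_div_smul (n := 3) (by norm_num) (toC eisR)
  push_cast at e1 e2
  norm_num at h
  refine toC_injective ?_
  simp only [map_mul, map_sub, map_qDeriv, map_ofNat]
  linear_combination 3 * h + e1 - e2

lemma ramanujan_R : 2 * qDeriv ℤ eisR = eisP * eisR - eisQ ^ 2 := by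
  have h := qSeries_eq_zero_of_weight_lt (k := 8) (by norm_num)
    (g := serreDerivative ((6 : ℤ) : ℂ) E₆ + (2⁻¹ : ℂ) • ((E₄ : ℍ → ℂ) * (E₄ : ℍ → ℂ)))
    ((serreDerivative_mdifferentiable _ (ModularFormClass.holo E₆)).add
      (((ModularFormClass.holo E₄).mul (ModularFormClass.holo E₄)).const_smul _))
    (fun γ ↦ by
      have h1 := serreDerivative_slash_invariant (ModularFormClass.holo E₆)
        (slash_eq_of_modularForm E₆ γ)
      have h2 := ModularForm.mul_slash_SL2 4 4 γ E₄ E₄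
      have h3 := slash_eq_of_modularForm E₄ γ
      norm_num at h1 h2 h3 ⊢
      rw [h2, h1, h3])
    ((hasQSeries_serreDerivative hasQSeries_E₆ _).add ((hasQSeries_E₄.mul hasQSeries_E₄).smul _))
    (by
      obtain ⟨h1, h2, h3⟩ := constantCoeff_toC_eis
      simp only [map_add, map_sub, coeff_qDeriv, PowerSeries.coeff_smul,
        coeff_zero_eq_constantCoeff_apply, map_mul, h1, h2, h3]
      norm_num)
  have e1 := natCast_mul_one_div_smul (n := 2) (by norm_num) (toC eisP * toC eisR)
  have e2 := natCast_mul_one_div_smul (n := 2) (by norm_num) (toC eisQ * toC eisQ)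
  push_cast at e1 e2
  norm_num at h
  refine toC_injective ?_
  simp only [map_mul, map_sub, map_pow, map_qDeriv, map_ofNat]
  linear_combination 2 * h + e1 - e2

lemma E2_slash_apply (γ : SL(2, ℤ)) (z : ℍ) :
    (E2 ∣[(2 : ℤ)] γ) z = E2 z + 12 * (2 * π * Complex.I)⁻¹ * ((γ 1 0 : ℂ) / denom γ z) := by
  rw [E2_slash_action]
  simp only [Pi.sub_apply, Pi.smul_apply, smul_eq_mul, D2, riemannZeta_two]
  have := denom_ne_zero γ z
  have hπ : (π : ℂ) ≠ 0 := by exact_mod_cast Real.pi_ne_zero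
  field_simp
  linear_combination (-12 * (γ 1 0 : ℂ)) * Complex.I_sq

lemma deriv_E2_slash (γ : SL(2, ℤ)) (z : ℍ) : D (E2 ∣[(2 : ℤ)] γ) z =
    D E2 z - 12 * ((2 * π * Complex.I)⁻¹ * ((γ 1 0 : ℂ) / denom γ z)) ^ 2 := by
  have h1 : HasDerivAt (E2 ∘ ofComplex) (deriv (E2 ∘ ofComplex) z) (z : ℂ) :=
    (UpperHalfPlane.mdifferentiableAt_iff.mp (E2_mdifferentiable z)).hasDerivAt
  have h2 := (hasDerivAt_denom_zpow γ (-1) z).const_mul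
    (12 * (2 * π * Complex.I)⁻¹ * (γ 1 0 : ℂ))
  have h3 : HasDerivAt ((E2 ∣[(2 : ℤ)] γ) ∘ ofComplex) _ (z : ℂ) :=
    (h1.add h2).congr_of_eventuallyEq (by
      filter_upwards [isOpen_upperHalfPlaneSet.mem_nhds z.im_pos] with w hw
      simp only [Function.comp_apply, E2_slash_apply, Pi.add_apply, ofComplex_apply_of_im_pos hw]
      rw [zpow_neg_one]
      ring)
  rw [normalizedDerivOfComplex, normalizedDerivOfComplex, h3.deriv]
  have := denom_ne_zero γ z
  norm_num
  field_simp
  simp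
  ring

/-- E₂ is only quasimodular. With j = (2πi)⁻¹ c/(cz + d), both D E₂ and E₂²/12 acquire the same
correction 2jE₂ + 12j² under the weight 4 slash action, so their difference is modular. -/
lemma ramanujan_P : 12 * qDeriv ℤ eisP = eisP ^ 2 - eisQ := by
  have h := qSeries_eq_zero_of_weight_lt (k := 4) (by norm_num)
    (g := serreDerivative 1 E2 + (12⁻¹ : ℂ) • (E₄ : ℍ → ℂ))
    ((serreDerivative_mdifferentiable _ E2_mdifferentiable).add
      ((ModularFormClass.holo E₄).const_smul _))
    (fun γ ↦ by
      have h1 := slash_eq_of_modularForm E₄ γ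
      have h2 : serreDerivative 1 E2 ∣[(4 : ℤ)] γ = serreDerivative 1 E2 := by
        have e1 : serreDerivative 1 E2 = D E2 - (12⁻¹ : ℂ) • (E2 * E2) := by
          ext z
          simp [serreDerivative_apply, mul_assoc]
        have e2 := ModularForm.mul_slash_SL2 2 2 γ E2 E2
        norm_num at e2
        ext z
        have e3 := congrFun (normalizedDerivOfComplex_SL_slash (k := 2) (γ := γ)
          E2_mdifferentiable) z
        rw [deriv_E2_slash] at e3
        norm_num [E2_slash_apply] at e3
        rw [e1]
        simp [sub_eq_add_neg, e2, E2_slash_apply]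
        linear_combination -e3
      norm_num at h1 h2 ⊢
      rw [h2, h1])
    ((hasQSeries_serreDerivative hasQSeries_E2 _).add (hasQSeries_E₄.smul _))
    (by
      obtain ⟨h1, h2, h3⟩ := constantCoeff_toC_eis
      simp only [map_add, map_sub, coeff_qDeriv, PowerSeries.coeff_smul,
        coeff_zero_eq_constantCoeff_apply, map_mul, h1, h2]
      norm_num)
  have e1 := natCast_mul_one_div_smul (n := 12) (by norm_num) (toC eisP * toC eisP)
  have e2 := natCast_mul_one_div_smul (n := 12) (by norm_num) (toC eisQ)
  push_cast at e1 e2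
  norm_num at h
  refine toC_injective ?_
  simp only [map_mul, map_sub, map_pow, map_qDeriv, map_ofNat]
  linear_combination 12 * h + e1 - e2

lemma ramanujanSystem : RamanujanSystem := ⟨ramanujan_P, ramanujan_Q, ramanujan_R⟩

end EisensteinCongruence

/-! ### Hecke operators at primes and the coefficients of eigenforms. -/

namespace EisensteinCongruence

open PowerSeries
open scoped Real

lemma heckeT_prime {p : ℕ} (hp : p.Prime) (k : ℕ) (hk : 1 ≤ k) (f : ℍ → ℂ) (τ : ℍ) :
    heckeT k p f τ = (p : ℂ)⁻¹ * ∑ b ∈ Finset.range p, f (ofComplex ((τ + b) / p)) +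
      (p : ℂ) ^ (k - 1) * f (ofComplex (p * τ)) := by
  have hp0 : (p : ℂ) ≠ 0 := by exact_mod_cast hp.ne_zero
  have hz : (p : ℂ) ^ ((k : ℤ) - 1) = (p : ℂ) ^ (k - 1) := by
    rw [← zpow_natCast, Nat.cast_sub hk, Nat.cast_one]
  rw [heckeT, Nat.sum_divisorsAntidiagonal (fun a d ↦ ∑ b ∈ Finset.range d,
    (d : ℂ) ^ (-(k : ℤ)) * f (ofComplex (((a : ℂ) * (τ : ℂ) + (b : ℂ)) / (d : ℂ)))),
    hp.sum_divisors, Nat.div_self hp.pos, Nat.div_one, add_comm]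
  simp only [Nat.cast_one, one_mul, one_zpow, Finset.range_one, Finset.sum_singleton,
    Nat.cast_zero, add_zero, div_one, mul_add, ← Finset.mul_sum]
  rw [← mul_assoc, hz]
  congr 2
  rw [← hz, ← zpow_add₀ hp0, ← zpow_neg_one]
  congr 1
  ring

lemma sum_exp_mul (p n : ℕ) (hp : 0 < p) :
    ∑ b ∈ Finset.range p, Complex.exp (2 * π * Complex.I * (n * b / p)) =
      if p ∣ n then (p : ℂ) else 0 := by
  have hζ := Complex.isPrimitiveRoot_exp p hp.ne'
  set ζ := Complex.exp (2 * π * Complex.I / p)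
  have h (b : ℕ) : Complex.exp (2 * π * Complex.I * (n * b / p)) = (ζ ^ n) ^ b := by
    rw [← pow_mul, ← Complex.exp_nat_mul]
    congr 1
    push_cast
    ring
  simp only [h]
  split_ifs with hd
  · simp [(hζ.pow_eq_one_iff_dvd n).mpr hd]
  · have h1 : ζ ^ n ≠ 1 := fun h1 ↦ hd ((hζ.pow_eq_one_iff_dvd n).mp h1)
    rw [geom_sum_eq h1, ← pow_mul, mul_comm, pow_mul, hζ.pow_eq_one]
    simp

/-- The Hecke operator `T_p`, `p` prime, on `q`-series. -/
lemma hasQSeries_heckeT {p : ℕ} (hp : p.Prime) {k : ℕ} (hk : 1 ≤ k) {f : ℍ → ℂ} {s : ℂ⟦X⟧}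
    (hf : HasQSeries f s) : HasQSeries (heckeT k p f)
      (.mk fun m ↦ coeff (p * m) s + if p ∣ m then (p : ℂ) ^ (k - 1) * coeff (m / p) s else 0) := by
  intro τ
  have hp0 : (p : ℂ) ≠ 0 := by exact_mod_cast hp.ne_zero
  have hpr : (0 : ℝ) < p := by exact_mod_cast hp.pos
  set q := Function.Periodic.qParam 1 τ with hq
  have hfz {z : ℂ} (hz : 0 < z.im) :
      HasSum (fun m ↦ coeff m s * Complex.exp (2 * π * Complex.I * (m * z))) (f (ofComplex z)) := by
    rw [ofComplex_apply_of_im_pos hz]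
    convert! hf ⟨z, hz⟩ using 2 with m
    rw [Function.Periodic.qParam, ← Complex.exp_nat_mul, smul_eq_mul]
    congr 2
    push_cast
    ring
  have hqe (m : ℕ) : Complex.exp (2 * π * Complex.I * (m * τ)) = q ^ m := by
    rw [hq, Function.Periodic.qParam, ← Complex.exp_nat_mul]
    congr 1
    push_cast
    ring
  rw [heckeT_prime hp k hk]
  have h1 : HasSum (fun m ↦ coeff (p * m) s * q ^ m)
      ((p : ℂ)⁻¹ * ∑ b ∈ Finset.range p, f (ofComplex ((τ + b) / p))) := by
    have h2 := (hasSum_sum (s := Finset.range p) fun b _ ↦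
      hfz (z := (τ + b) / p) (by
        rw [show ((τ : ℂ) + b) / p = (τ + b) / ((p : ℝ) : ℂ) by simp, Complex.div_ofReal_im]
        simpa using div_pos τ.im_pos hpr)).mul_left (p : ℂ)⁻¹
    have hinj : Function.Injective (fun m : ℕ ↦ p * m) := fun a b hab ↦
      Nat.eq_of_mul_eq_mul_left hp.pos hab
    -- Averaging over b keeps exactly the exponents divisible by p, by orthogonality of roots of
    -- unity.
    have h3 (n : ℕ) : (p : ℂ)⁻¹ * ∑ b ∈ Finset.range p,
        coeff n s * Complex.exp (2 * π * Complex.I * (n * ((τ + b) / p))) =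
        if p ∣ n then coeff n s * Complex.exp (2 * π * Complex.I * (n * τ / p)) else 0 := by
      have h4 (b : ℕ) : coeff n s * Complex.exp (2 * π * Complex.I * (n * ((τ + b) / p))) =
          coeff n s * Complex.exp (2 * π * Complex.I * (n * τ / p)) *
            Complex.exp (2 * π * Complex.I * (n * b / p)) := by
        rw [mul_assoc (coeff n s), ← Complex.exp_add]
        congr 2
        ring
      simp only [h4, ← Finset.mul_sum, sum_exp_mul p n hp.pos]
      split_ifs
      · field_simp
      · simp
    simp only [h3] at h2
    rw [← hinj.hasSum_iff] at h2
    · convert! h2 using 2 with m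
      simp only [Function.comp_apply, dvd_mul_right, if_true, ← hqe]
      congr 3
      push_cast
      field_simp
    · intro x hx
      rw [if_neg]
      rintro ⟨c, rfl⟩
      exact hx ⟨c, rfl⟩
  have h2 : HasSum (fun m ↦ (if p ∣ m then (p : ℂ) ^ (k - 1) * coeff (m / p) s else 0) * q ^ m)
      ((p : ℂ) ^ (k - 1) * f (ofComplex (p * τ))) := by
    have h3 := (hfz (z := p * τ) (by
      rw [show (p : ℂ) = ((p : ℝ) : ℂ) by simp, Complex.im_ofReal_mul]
      exact mul_pos hpr τ.im_pos)).mul_left ((p : ℂ) ^ (k - 1))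
    have hinj : Function.Injective (fun m : ℕ ↦ p * m) := fun a b hab ↦
      Nat.eq_of_mul_eq_mul_left hp.pos hab
    rw [← hinj.hasSum_iff]
    · convert! h3 using 2 with m
      simp only [Function.comp_apply, dvd_mul_right, if_true, Nat.mul_div_cancel_left m hp.pos,
        ← hqe]
      rw [mul_assoc]
      congr 4
      push_cast
      ring
    · intro x hx
      rw [if_neg, zero_mul]
      rintro ⟨c, rfl⟩
      exact hx ⟨c, rfl⟩
  convert! h1.add h2 using 2 with m
  rw [coeff_mk, smul_eq_mul, add_mul]

/-- Coefficients of eigenforms: the action of `T_p`, `p` prime. -/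
lemma eigenform_coeff_mul {k : ℕ} (hk : 1 ≤ k) {f : CuspForm 𝒮ℒ (k : ℤ)} (hf : IsEigenform f)
    {p : ℕ} (hp : p.Prime) (m : ℕ) : fourierCoeff1 f p * fourierCoeff1 f m =
      fourierCoeff1 f (p * m) + if p ∣ m then (p : ℂ) ^ (k - 1) * fourierCoeff1 f (m / p) else 0 := by
  obtain ⟨c, hc⟩ := hf.eigen p hp.one_lt.le
  have h1 := hasQSeries_heckeT hp hk (hasQSeries_modularForm f)
  have h2 : HasQSeries (heckeT k p f) (c • qExpansion 1 f) := by
    rw [show heckeT k p f = c • (f : ℍ → ℂ) from funext hc]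
    exact (hasQSeries_modularForm f).smul c
  have h3 := h1.unique h2
  have h4 (m : ℕ) := congrArg (coeff m) h3
  simp only [coeff_mk, PowerSeries.coeff_smul, smul_eq_mul] at h4
  -- The coefficient of q identifies the eigenvalue c with the p-th coefficient of f.
  have h5 := h4 1
  have hn : coeff 1 (qExpansion 1 f) = 1 := hf.normalised
  rw [if_neg (fun h ↦ hp.one_lt.ne' (Nat.dvd_one.mp h)), mul_one, add_zero, hn, mul_one] at h5
  rw [fourierCoeff1, fourierCoeff1, h5]
  exact (h4 m).symm

end EisensteinCongruence

/-! ### Bases of level one forms. -/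

namespace EisensteinCongruence

open PowerSeries ModularForm

lemma hasQSeries_discriminant : HasQSeries CuspForm.discriminant (toC deltaZ) := by
  have h1 : HasQSeries CuspForm.discriminant (qExpansion 1 CuspForm.discriminant) :=
    hasQSeries_modularForm _
  have h2 : HasQSeries ((1728 : ℂ) • (CuspForm.discriminant : ℍ → ℂ))
      (toC eisQ * (toC eisQ * toC eisQ) - toC eisR * toC eisR) := by
    have h := (hasQSeries_E₄.mul (hasQSeries_E₄.mul hasQSeries_E₄)).sub
      (hasQSeries_E₆.mul hasQSeries_E₆)
    convert! h using 1
    ext z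
    simp only [CuspForm.coe_discriminant, Pi.smul_apply, smul_eq_mul,
      discriminant_eq_E₄_cube_sub_E₆_sq, Pi.sub_apply, Pi.mul_apply]
    ring
  have h3 := (h1.smul 1728).unique h2
  have h4 := congrArg toC (deltaZ_mul ramanujanSystem)
  simp only [map_mul, map_sub, map_pow, map_ofNat] at h4
  have h5 : toC deltaZ = qExpansion 1 CuspForm.discriminant := by
    refine mul_left_cancel₀ (show (1728 : ℂ⟦X⟧) ≠ 0 from fun h ↦ ?_) ?_
    · simpa [map_ofNat] using congrArg constantCoeff h
    · rw [h4, show (1728 : ℂ⟦X⟧) = C (1728 : ℂ) from rfl, ← PowerSeries.smul_eq_C_mul, h3]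
      ring
  rwa [h5]

lemma modularForm_eq_zero_of_neg_or_two {k : ℤ} (hk : k < 0 ∨ k = 2) (f : ModularForm 𝒮ℒ k) :
    f = 0 := by
  rcases hk with hk | rfl
  · exact rank_zero_iff_forall_zero.mp (levelOne_neg_weight_rank_zero hk) f
  · exact rank_zero_iff_forall_zero.mp levelOne_weight_two_rank_zero f

lemma qExpansion_cuspForm {k : ℤ} (f : CuspForm 𝒮ℒ k) :
    qExpansion 1 f = toC deltaZ * qExpansion 1 (CuspForm.discriminantEquiv f) := by
  have h := hasQSeries_discriminant.mul (hasQSeries_modularForm (CuspForm.discriminantEquiv f))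
  rw [CuspForm.coe_discriminant, discriminant_mul_discriminantEquiv] at h
  exact (hasQSeries_modularForm f).unique h

/-- Modular forms of level one in terms of `Δ`, `E₄` and `E₆`. -/
theorem exists_qExpansion_modularForm (b : ℕ) (hb : b ≤ 1) (a : ℕ) {k : ℤ} (hk : k = 4 * a + 6 * b)
    (g : ModularForm 𝒮ℒ k) : ∃ c : ℕ → ℂ, qExpansion 1 g =
      ∑ i ∈ Finset.range (a / 3 + 1), c i • toC (deltaZ ^ i * eisQ ^ (a - 3 * i) * eisR ^ b) := by
  induction a using Nat.strong_induction_on generalizing k with | _ a ih =>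
  -- A form with constant term 1: subtracting a multiple leaves a cusp form, and division by Δ
  -- lowers a by 3.
  let e : ModularForm 𝒮ℒ k := ModularForm.mcast (by rw [hk]; ring)
    ((E₄.pow a).mul (E₆.pow b))
  have he : qExpansion 1 e = toC (eisQ ^ a * eisR ^ b) := by
    rw [ModularForm.qExpansion_mcast, ModularForm.qExpansion_mul one_pos one_mem_strictPeriods_SL,
      ModularForm.qExpansion_pow one_pos one_mem_strictPeriods_SL,
      ModularForm.qExpansion_pow one_pos one_mem_strictPeriods_SL, qExpansion_E₄, qExpansion_E₆]
    simp
  obtain ⟨-, h2, h3⟩ := constantCoeff_toC_eis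
  set c₀ := coeff 0 (qExpansion 1 g)
  have hq : qExpansion 1 (g - c₀ • e) = qExpansion 1 g - c₀ • toC (eisQ ^ a * eisR ^ b) := by
    have h1 := ModularForm.qExpansion_sub one_pos one_mem_strictPeriods_SL g (c₀ • e)
    have h2 := ModularForm.qExpansion_smul one_pos one_mem_strictPeriods_SL c₀ e
    rw [← he, ← h2]
    exact h1
  have h0 : coeff 0 (qExpansion 1 (g - c₀ • e)) = 0 := by
    rw [hq]
    simp [h2, h3, c₀]
  have h1 := qExpansion_cuspForm (ModularForm.toCuspForm (g - c₀ • e) h0)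
  set g' := CuspForm.discriminantEquiv (ModularForm.toCuspForm (g - c₀ • e) h0)
  have h1' : qExpansion 1 g = c₀ • toC (eisQ ^ a * eisR ^ b) + toC deltaZ * qExpansion 1 g' := by
    rw [← h1]
    refine eq_add_of_sub_eq' ?_
    rw [← hq]
    rfl
  rcases lt_or_ge a 3 with ha | ha
  · refine ⟨fun _ ↦ c₀, ?_⟩
    -- For a ≤ 2 and b ≤ 1 the weight 4a + 6b − 12 is negative or equal to 2.
    have hg' : g' = 0 := modularForm_eq_zero_of_neg_or_two (by omega) g'
    rw [h1', hg', Nat.div_eq_of_lt ha, show qExpansion 1 ((0 : ModularForm 𝒮ℒ (k - 12)) : ℍ → ℂ) = 0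
      from qExpansion_zero 1]
    simp
  · obtain ⟨c, hc⟩ := ih (a - 3) (by omega) (k := k - 12) (by omega) g'
    refine ⟨fun i ↦ if i = 0 then c₀ else c (i - 1), ?_⟩
    rw [h1', hc, show a / 3 + 1 = (a - 3) / 3 + 1 + 1 by omega, Finset.sum_range_succ' _ (_ + 1),
      add_comm, Finset.mul_sum]
    congr 1
    · refine Finset.sum_congr rfl fun i _ ↦ ?_
      dsimp only
      rw [mul_smul_comm, ← map_mul, if_neg (by omega), Nat.add_sub_cancel,
        show a - 3 * (i + 1) = a - 3 - 3 * i by omega]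
      congr 2
      ring
    · simp

/-- Cusp forms of level one in terms of `Δ`, `E₄` and `E₆`. -/
theorem exists_qExpansion_cuspForm {a b : ℕ} (hb : b ≤ 1) {k : ℤ} (hk : k = 12 + 4 * a + 6 * b)
    (f : CuspForm 𝒮ℒ k) : ∃ c : ℕ → ℂ, ∀ n, fourierCoeff1 f n =
      ∑ i ∈ Finset.range (a / 3 + 1),
        c i * (coeff n (deltaZ ^ (i + 1) * eisQ ^ (a - 3 * i) * eisR ^ b) : ℤ) := by
  obtain ⟨c, hc⟩ := exists_qExpansion_modularForm b hb a (k := k - 12) (by omega)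
    (CuspForm.discriminantEquiv f)
  refine ⟨c, fun n ↦ ?_⟩
  rw [fourierCoeff1, qExpansion_cuspForm, hc, Finset.mul_sum, map_sum]
  refine Finset.sum_congr rfl fun i _ ↦ ?_
  rw [mul_smul_comm, ← map_mul, PowerSeries.coeff_smul, smul_eq_mul, coeff_map, eq_intCast,
    pow_succ']
  simp only [mul_assoc]

/-- Division by Δ excludes k = 14, where the quotient has weight 2, and odd k. -/
lemma exists_weight_decomposition {k : ℕ} (hk : 12 ≤ k) (hk' : k ≤ 46)
    {f : CuspForm 𝒮ℒ (k : ℤ)} (hf : fourierCoeff1 f 1 = 1) :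
    (∃ a ≤ 8, k = 12 + 4 * a) ∨ ∃ a ≤ 7, k = 18 + 4 * a := by
  have hne : CuspForm.discriminantEquiv f ≠ 0 := by
    intro h
    rw [fourierCoeff1, qExpansion_cuspForm, h,
      show qExpansion 1 ((0 : ModularForm 𝒮ℒ ((k : ℤ) - 12)) : ℍ → ℂ) = 0 from qExpansion_zero 1]
      at hf
    simp at hf
  rcases Nat.even_or_odd k with he | ho
  · have : k ≠ 14 := by
      rintro rfl
      exact hne (modularForm_eq_zero_of_neg_or_two (by norm_num) _)
    rcases Nat.even_or_odd (k / 2) with h2 | h2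
    · exact Or.inl ⟨(k - 12) / 4, by grind⟩
    · exact Or.inr ⟨(k - 18) / 4, by grind⟩
  · exact absurd (ModularForm.levelOne_odd_weight_eq_zero (by grind) _) hne

end EisensteinCongruence

/-! ### Tables of coefficients, and integrality from Hecke relations. -/

namespace EisensteinCongruence

open PowerSeries

/-- The Cauchy product of two sequences. -/
def conv (u v : ℕ → ℤ) (n : ℕ) : ℤ := ((List.range (n + 1)).map fun i ↦ u i * v (n - i)).sum

/-- The first ten coefficients of `p` are given by `u`. -/
def Agree (p : ℤ⟦X⟧) (u : ℕ → ℤ) : Prop := ∀ n < 10, coeff n p = u n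

/-- Ten coefficients are enough: the Hecke relations used reach a_9. -/
lemma Agree.mul {p q : ℤ⟦X⟧} {u v : ℕ → ℤ} (hp : Agree p u) (hq : Agree q v) :
    Agree (p * q) (conv u v) := by
  intro n hn
  rw [coeff_mul, Finset.Nat.sum_antidiagonal_eq_sum_range_succ (fun i j ↦ coeff i p * coeff j q),
    conv, ← List.sum_toFinset _ List.nodup_range, List.toFinset_range]
  refine Finset.sum_congr rfl fun i hi ↦ ?_
  rw [hp i (by grind), hq (n - i) (by grind)]

lemma Agree.congr {p : ℤ⟦X⟧} {u v : ℕ → ℤ} (hp : Agree p u) (h : ∀ n < 10, u n = v n) :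
    Agree p v := fun n hn ↦ (hp n hn).trans (h n hn)

/-- Coefficients of the powers of the weight `4` Eisenstein series. -/
def eisQPowTable : ℕ → List ℤ
  | 0 =>
    [1, 0, 0, 0, 0, 0, 0, 0, 0, 0]
  | 1 =>
    [1, 240, 2160, 6720, 17520, 30240, 60480, 82560, 140400, 181680]
  | 2 =>
    [1, 480, 61920, 1050240, 7926240, 37500480, 135480960, 395301120, 1014559200, 2296875360]
  | 3 =>
    [1, 720, 179280, 16954560, 396974160, 4632858720, 34413301440, 187477879680, 814940600400,
      2975469665040]
  | 4 =>
    [1, 960, 354240, 61543680, 4858169280, 137745912960, 2120861041920, 21423820362240,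
      158753769048000, 928983317334720]
  | 5 =>
    [1, 1200, 586800, 148641600, 20400279600, 1439038231200, 46093334702400, 861697555612800,
      10894180752126000, 102121497049868400]
  | 6 =>
    [1, 1440, 876960, 292072320, 57349833120, 6660135541440, 436536302762880, 15172132360815360,
      327295477379498400, 4913576699608450080]
  | 7 =>
    [1, 1680, 1224720, 505659840, 129351117840, 21060890131680, 2160822606183360,
      134717272385473920, 4957295423282269200, 119288258695393463760]
  | 8 =>
    [1, 1920, 1630080, 803228160, 253366181760, 53205643249920, 7498254194403840,
      699684356363412480, 42100628403784982400, 1614922125605880493440]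
  | _ => []

/-- Coefficients of the weight `6` Eisenstein series. -/
def eisRTable : List ℤ :=
    [1, -504, -16632, -122976, -532728, -1575504, -4058208, -8471232, -17047800, -29883672]

/-- Coefficients of the discriminant. -/
def deltaTable : List ℤ := [0, 1, -24, 252, -1472, 4830, -6048, -16744, 84480, -113643]

/-- Coefficients of a constant power series. -/
def oneTable : List ℤ := [1]

lemma agree_one : Agree 1 (oneTable.getD · 0) := by
  intro n hn
  interval_cases n <;> simp [oneTable, coeff_one]

lemma agree_eisQ : Agree eisQ ((eisQPowTable 1).getD · 0) := by
  intro n hn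
  rw [eisQ, show (240 : ℤ⟦X⟧) = C (240 : ℤ) from rfl, map_add, coeff_C_mul, sigmaSeries, coeff_mk,
    coeff_one]
  interval_cases n <;> decide +kernel

lemma agree_eisR : Agree eisR (eisRTable.getD · 0) := by
  intro n hn
  rw [eisR, show (504 : ℤ⟦X⟧) = C (504 : ℤ) from rfl, map_sub, coeff_C_mul, sigmaSeries, coeff_mk,
    coeff_one]
  interval_cases n <;> decide +kernel

lemma agree_eisQ_pow {a : ℕ} (ha : a ≤ 8) : Agree (eisQ ^ a) ((eisQPowTable a).getD · 0) := by
  induction a with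
  | zero => exact agree_one.congr (by decide +kernel)
  | succ a ih =>
    rw [pow_succ]
    refine ((ih (by omega)).mul agree_eisQ).congr ?_
    have ha' : a ≤ 7 := by omega
    clear ih ha
    interval_cases a <;> decide +kernel

lemma agree_deltaZ : Agree deltaZ (deltaTable.getD · 0) := by
  intro n hn
  have h3 : coeff n (eisQ ^ 3) = (eisQPowTable 3).getD n 0 := agree_eisQ_pow (by norm_num) n hn
  have h2 := agree_eisR.mul agree_eisR n hn
  rw [deltaZ, coeff_mk, map_sub, h3, pow_two, h2]
  interval_cases n <;> decide +kernel

/-- The first coefficients of `Δ ^ (i + 1) * E₄ ^ (a - 3 * i) * E₆ ^ b` for `i ≤ 2`, `b ≤ 1`. -/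
def basisCoeff (a b i : ℕ) : ℕ → ℤ :=
  conv (conv
    (match i with
      | 0 => (deltaTable.getD · 0)
      | 1 => conv (deltaTable.getD · 0) (deltaTable.getD · 0)
      | _ => conv (conv (deltaTable.getD · 0) (deltaTable.getD · 0)) (deltaTable.getD · 0))
    ((eisQPowTable (a - 3 * i)).getD · 0))
    (match b with
      | 0 => (oneTable.getD · 0)
      | _ => (eisRTable.getD · 0))

lemma agree_basisCoeff {a b i : ℕ} (ha : a ≤ 8) (hb : b ≤ 1) (hi : i ≤ 2) :
    Agree (deltaZ ^ (i + 1) * eisQ ^ (a - 3 * i) * eisR ^ b) (basisCoeff a b i) := by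
  refine .mul (.mul ?_ (agree_eisQ_pow (by omega))) ?_
  · interval_cases i
    · simpa using agree_deltaZ
    · simpa [pow_two] using agree_deltaZ.mul agree_deltaZ
    · simpa [pow_succ] using (agree_deltaZ.mul agree_deltaZ).mul agree_deltaZ
  · interval_cases b
    · simpa using agree_one
    · simpa using agree_eisR

section Integrality

/-- Two numbers are integral if they span a ring together with `1`. -/
lemma isIntegral_of_mul_table {A : Type*} [CommRing A] {x y : A} {a b c : Fin 3 → ℤ}
    (hxx : x * x = a 0 + a 1 * x + a 2 * y) (hxy : x * y = b 0 + b 1 * x + b 2 * y)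
    (hyy : y * y = c 0 + c 1 * x + c 2 * y) : IsIntegral ℤ x ∧ IsIntegral ℤ y := by
  let S : Submodule ℤ A := Submodule.span ℤ {1, x, y}
  have h1 : (1 : A) ∈ S := Submodule.subset_span (by simp)
  have hx : x ∈ S := Submodule.subset_span (by simp)
  have hy : y ∈ S := Submodule.subset_span (by simp)
  have hlin (d : Fin 3 → ℤ) : (d 0 + d 1 * x + d 2 * y : A) ∈ S := by
    have := S.add_mem (S.add_mem (S.smul_mem (d 0) h1) (S.smul_mem (d 1) hx)) (S.smul_mem (d 2) hy)
    simpa [zsmul_eq_mul] using this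
  have hmul : S * S ≤ S := by
    rw [Submodule.span_mul_span, Submodule.span_le]
    rintro _ ⟨u, hu, v, hv, rfl⟩
    simp only [Set.mem_insert_iff, Set.mem_singleton_iff] at hu hv
    rcases hu with rfl | rfl | rfl <;> rcases hv with rfl | rfl | rfl <;>
      simp only [one_mul, mul_one, SetLike.mem_coe] <;> try assumption
    · rw [hxx]; exact hlin a
    · rw [hxy]; exact hlin b
    · rw [mul_comm, hxy]; exact hlin b
    · rw [hyy]; exact hlin c
  have hfg : S.FG := Submodule.fg_span (by simp)
  let T : Subalgebra ℤ A := S.toSubalgebra h1 fun u v hu hv ↦ hmul (Submodule.mul_mem_mul hu hv)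
  have hT : (Subalgebra.toSubmodule T).FG := hfg
  exact ⟨IsIntegral.of_mem_of_fg T hT x hx, IsIntegral.of_mem_of_fg T hT y hy⟩

/-- The divisibility by which the second coordinate of an eigenform is `u` times an integer. -/
def QuadraticDvd (h : ℕ → ℕ → ℤ) (k : ℕ) (u : ℤ) : Prop :=
  u ^ 2 ∣ h 0 4 + 2 ^ (k - 1) - h 0 2 ^ 2 ∧ u ∣ h 1 4 - 2 * h 0 2

/-- The divisibility by which the second and third coordinates of an eigenform are integers,
times `u` and `v` respectively. -/
def CubicDvd (h : ℕ → ℕ → ℤ) (k : ℕ) (u v : ℤ) : Prop :=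
  let s := h 1 3
  let p₀ := h 0 4 + 2 ^ (k - 1) - h 0 2 ^ 2
  let p₁ := h 1 4 - 2 * h 0 2
  let p₂ := h 2 4
  let q₀ := h 0 6 - h 0 2 * h 0 3 - s * p₀
  let q₁ := h 1 6 - h 0 2 * s - h 0 3 - s * p₁
  let q₂ := h 2 6 - h 0 2 - s * p₂
  let r₀ := h 0 9 + 3 ^ (k - 1) - h 0 3 ^ 2 - s ^ 2 * p₀ - 2 * s * q₀
  let r₁ := h 1 9 - 2 * h 0 3 * s - s ^ 2 * p₁ - 2 * s * q₁
  let r₂ := h 2 9 - 2 * h 0 3 - s ^ 2 * p₂ - 2 * s * q₂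
  (u ^ 2 ∣ p₀ ∧ u ∣ p₁ ∧ u ^ 2 ∣ v * p₂) ∧ (u * v ∣ q₀ ∧ v ∣ q₁ ∧ u ∣ q₂) ∧
    v ^ 2 ∣ r₀ ∧ v ^ 2 ∣ u * r₁ ∧ v ∣ r₂

instance (h : ℕ → ℕ → ℤ) (k : ℕ) (u : ℤ) : Decidable (QuadraticDvd h k u) :=
  inferInstanceAs (Decidable (_ ∧ _))

instance (h : ℕ → ℕ → ℤ) (k : ℕ) (u v : ℤ) : Decidable (CubicDvd h k u v) :=
  inferInstanceAs (Decidable (_ ∧ _))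

/-- The relation a_2² = a_4 + 2^(k−1), with a_2 = h 0 2 + u x, is a quadratic equation for u x.
Divided by u², it becomes monic and integral in x. -/
lemma isIntegral_of_quadraticDvd {h : ℕ → ℕ → ℤ} {k : ℕ} {u : ℤ} (hu : u ≠ 0)
    (hd : QuadraticDvd h k u) {x : ℂ}
    (h4 : (h 0 2 + u * x) ^ 2 = h 0 4 + u * x * h 1 4 + 2 ^ (k - 1)) : IsIntegral ℤ x := by
  obtain ⟨⟨a₀, ha₀⟩, a₁, ha₁⟩ := hd
  have hu' : (u : ℂ) ≠ 0 := by exact_mod_cast hu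
  have e₀ := congrArg (Int.cast (R := ℂ)) ha₀
  have e₁ := congrArg (Int.cast (R := ℂ)) ha₁
  push_cast at e₀ e₁
  refine (isIntegral_of_mul_table (x := x) (y := 0) (a := ![a₀, a₁, 0]) (b := 0) (c := 0)
    ?_ (by simp) (by simp)).1
  refine mul_left_cancel₀ (pow_ne_zero 2 hu') ?_
  simp only [Matrix.cons_val]
  linear_combination h4 + e₀ + u * x * e₁

/-- With X = u x and Y = v y, the relations for a_2², a_2 a_3 and a_3² give X², XY and Y² in terms
of 1, X, Y, with coefficients pᵢ, qᵢ and rᵢ of `CubicDvd`. Division by u², uv and v² yields an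
integral multiplication table for x and y. -/
lemma isIntegral_of_cubicDvd {h : ℕ → ℕ → ℤ} {k : ℕ} {u v : ℤ} (hu : u ≠ 0) (hv : v ≠ 0)
    (hd : CubicDvd h k u v) {x y : ℂ}
    (h4 : (h 0 2 + u * x) ^ 2 = h 0 4 + u * x * h 1 4 + v * y * h 2 4 + 2 ^ (k - 1))
    (h6 : (h 0 2 + u * x) * (h 0 3 + u * x * h 1 3 + v * y) =
      h 0 6 + u * x * h 1 6 + v * y * h 2 6)
    (h9 : (h 0 3 + u * x * h 1 3 + v * y) ^ 2 =
      h 0 9 + u * x * h 1 9 + v * y * h 2 9 + 3 ^ (k - 1)) : IsIntegral ℤ x ∧ IsIntegral ℤ y := by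
  obtain ⟨⟨⟨a₀, ha₀⟩, ⟨a₁, ha₁⟩, a₂, ha₂⟩, ⟨⟨b₀, hb₀⟩, ⟨b₁, hb₁⟩, b₂, hb₂⟩,
    ⟨c₀, hc₀⟩, ⟨c₁, hc₁⟩, c₂, hc₂⟩ := hd
  have hu' : (u : ℂ) ≠ 0 := by exact_mod_cast hu
  have hv' : (v : ℂ) ≠ 0 := by exact_mod_cast hv
  have e₀ := congrArg (Int.cast (R := ℂ)) ha₀
  have e₁ := congrArg (Int.cast (R := ℂ)) ha₁
  have e₂ := congrArg (Int.cast (R := ℂ)) ha₂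
  have f₀ := congrArg (Int.cast (R := ℂ)) hb₀
  have f₁ := congrArg (Int.cast (R := ℂ)) hb₁
  have f₂ := congrArg (Int.cast (R := ℂ)) hb₂
  have g₀ := congrArg (Int.cast (R := ℂ)) hc₀
  have g₁ := congrArg (Int.cast (R := ℂ)) hc₁
  have g₂ := congrArg (Int.cast (R := ℂ)) hc₂
  push_cast at e₀ e₁ e₂ f₀ f₁ f₂ g₀ g₁ g₂
  refine isIntegral_of_mul_table (a := ![a₀, a₁, a₂]) (b := ![b₀, b₁, b₂]) (c := ![c₀, c₁, c₂])
    ?_ ?_ ?_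
  · refine mul_left_cancel₀ (pow_ne_zero 2 hu') ?_
    simp only [Matrix.cons_val]
    linear_combination h4 + e₀ + u * x * e₁ + y * e₂
  · refine mul_left_cancel₀ (mul_ne_zero hu' hv') ?_
    simp only [Matrix.cons_val]
    linear_combination h6 - h 1 3 * h4 + f₀ + u * x * f₁ + v * y * f₂
  · refine mul_left_cancel₀ (pow_ne_zero 2 hv') ?_
    simp only [Matrix.cons_val]
    linear_combination h9 - h 1 3 ^ 2 * h4 - 2 * h 1 3 * (h6 - h 1 3 * h4) +
      g₀ + x * g₁ + v * y * g₂

end Integrality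

lemma basisCoeff_quadraticDvd : (∀ a ∈ [3, 4, 5], QuadraticDvd (basisCoeff a 0) (12 + 4 * a) 8) ∧
    ∀ a ∈ [3, 4, 5], QuadraticDvd (basisCoeff a 1) (18 + 4 * a) 16 := by
  decide +kernel

lemma basisCoeff_cubicDvd : (∀ a ∈ [6, 7, 8], CubicDvd (basisCoeff a 0) (12 + 4 * a) 8 128) ∧
    ∀ a ∈ [6, 7], CubicDvd (basisCoeff a 1) (18 + 4 * a) 16 128 := by
  decide +kernel

lemma basisCoeff_echelon : ∀ a ≤ 8, ∀ b ≤ 1, basisCoeff a b 0 1 = 1 ∧ basisCoeff a b 1 1 = 0 ∧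
    basisCoeff a b 1 2 = 1 ∧ basisCoeff a b 2 1 = 0 ∧ basisCoeff a b 2 2 = 0 ∧
    basisCoeff a b 2 3 = 1 := by
  decide +kernel

end EisensteinCongruence

/-! ### Integral coordinates of eigenforms, and the conclusion. -/

namespace EisensteinCongruence

open PowerSeries

/-- The coordinates of an eigenform in the basis `Δ ^ (i + 1) * E₄ ^ (a - 3 * i) * E₆ ^ b` are
divisible algebraic integers. -/
theorem exists_integral_coordinates {k a b : ℕ} (ha : a ≤ 8) (hb : b ≤ 1)
    (hk : k = 12 + 4 * a + 6 * b) {u v : ℤ} (hu : u ≠ 0) (hv : v ≠ 0)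
    (hq : a ∈ [3, 4, 5] → QuadraticDvd (basisCoeff a b) k u)
    (hc : a ∈ [6, 7, 8] → CubicDvd (basisCoeff a b) k u v)
    {f : CuspForm 𝒮ℒ (k : ℤ)} (hf : IsEigenform f) :
    ∃ x y : ℂ, IsIntegral ℤ x ∧ IsIntegral ℤ y ∧ ∀ n, fourierCoeff1 f n =
      (coeff n (deltaZ * eisQ ^ a * eisR ^ b) : ℤ) +
      u * x * (coeff n (deltaZ ^ 2 * eisQ ^ (a - 3) * eisR ^ b) : ℤ) +
      v * y * (coeff n (deltaZ ^ 3 * eisQ ^ (a - 6) * eisR ^ b) : ℤ) := by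
  obtain ⟨c, hc'⟩ := exists_qExpansion_cuspForm (k := (k : ℤ)) (a := a) hb
    (by rw [hk]; push_cast; ring) f
  have hu' : (u : ℂ) ≠ 0 := by exact_mod_cast hu
  have hv' : (v : ℂ) ≠ 0 := by exact_mod_cast hv
  obtain ⟨e1, e2, e3, e4, e5, e6⟩ := basisCoeff_echelon a ha b hb
  have hB (i n : ℕ) (hi : i ≤ 2) (hn : n < 10) := agree_basisCoeff ha hb hi n hn
  -- Padding to three terms: where the subtractions a − 3 or a − 6 truncate, the coefficient in
  -- front is 0.
  obtain ⟨c₁, c₂, hA, h1, h2⟩ : ∃ c₁ c₂ : ℂ, (∀ n, fourierCoeff1 f n =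
      c 0 * (coeff n (deltaZ ^ (0 + 1) * eisQ ^ (a - 3 * 0) * eisR ^ b) : ℤ) +
      c₁ * (coeff n (deltaZ ^ (1 + 1) * eisQ ^ (a - 3 * 1) * eisR ^ b) : ℤ) +
      c₂ * (coeff n (deltaZ ^ (2 + 1) * eisQ ^ (a - 3 * 2) * eisR ^ b) : ℤ)) ∧
      (a < 3 → c₁ = 0) ∧ (a < 6 → c₂ = 0) := by
    have : a / 3 = 0 ∨ a / 3 = 1 ∨ a / 3 = 2 := by omega
    rcases this with h | h | h <;> rw [h] at hc'
    · exact ⟨0, 0, fun n ↦ by rw [hc' n]; simp, fun _ ↦ rfl, fun _ ↦ rfl⟩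
    · exact ⟨c 1, 0, fun n ↦ by rw [hc' n]; simp [Finset.sum_range_succ], by omega, fun _ ↦ rfl⟩
    · exact ⟨c 1, c 2, fun n ↦ by rw [hc' n]; simp [Finset.sum_range_succ], by omega, by omega⟩
  have h0 : c 0 = 1 := by
    have := hA 1
    rw [hf.normalised, hB 0 1 (by simp) (by simp), hB 1 1 (by simp) (by simp),
      hB 2 1 (by simp) (by simp), e1, e2, e4] at this
    simpa using this.symm
  have hA' (n : ℕ) (hn : n < 10) : fourierCoeff1 f n = basisCoeff a b 0 n +
      u * (c₁ / u) * basisCoeff a b 1 n + v * (c₂ / v) * basisCoeff a b 2 n := by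
    rw [hA, hB 0 n (by simp) hn, hB 1 n (by simp) hn, hB 2 n (by simp) hn, h0,
      mul_div_cancel₀ _ hu', mul_div_cancel₀ _ hv', one_mul]
  have hk1 : 1 ≤ k := by omega
  have m4 := eigenform_coeff_mul hk1 hf Nat.prime_two 2
  have m6 := eigenform_coeff_mul hk1 hf Nat.prime_two 3
  have m9 := eigenform_coeff_mul hk1 hf Nat.prime_three 3
  norm_num [hf.normalised] at m4 m6 m9
  rw [hA' 2 (by simp), hA' 4 (by simp), e3, e5] at m4
  rw [hA' 2 (by simp), hA' 3 (by simp), hA' 6 (by simp), e3, e5, e6] at m6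
  rw [hA' 3 (by simp), hA' 9 (by simp), e6] at m9
  push_cast at m4 m6 m9
  have hint : IsIntegral ℤ (c₁ / u) ∧ IsIntegral ℤ (c₂ / v) := by
    rcases lt_or_ge a 6 with h6 | h6
    · rw [h2 h6, zero_div] at m4 ⊢
      refine ⟨?_, isIntegral_zero⟩
      rcases lt_or_ge a 3 with h3 | h3
      · rw [h1 h3, zero_div]
        exact isIntegral_zero
      · refine isIntegral_of_quadraticDvd hu (hq (by simp; omega)) ?_
        linear_combination m4
    · refine isIntegral_of_cubicDvd hu hv (hc (by simp; omega)) ?_ ?_ ?_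
      · linear_combination m4
      · linear_combination m6
      · linear_combination m9
  refine ⟨c₁ / u, c₂ / v, hint.1, hint.2, fun n ↦ ?_⟩
  rw [hA, h0, mul_div_cancel₀ _ hu', mul_div_cancel₀ _ hv', one_mul]
  simp

/-- Integral coordinates and congruences for the basis give congruences for an eigenform. -/
lemma algIntModEq_of_coordinates {x y : ℂ} (hx : IsIntegral ℤ x) (hy : IsIntegral ℤ y)
    {u h₀ h₁ h₂ s : ℤ} (h0 : 128 ∣ h₀ - s) (h1 : 128 ∣ u * h₁) {z : ℂ}
    (hz : z = h₀ + u * x * h₁ + (128 : ℤ) * y * h₂) : AlgIntModEq 128 z s := by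
  obtain ⟨d, hd⟩ := h0
  obtain ⟨e, he⟩ := h1
  have hd' := congrArg (Int.cast (R := ℂ)) hd
  have he' := congrArg (Int.cast (R := ℂ)) he
  push_cast at hd' he' hz ⊢
  refine ⟨d + e * x + h₂ * y, ?_, ?_⟩
  · have hi (m : ℤ) : IsIntegral ℤ (m : ℂ) := isIntegral_algebraMap (R := ℤ) (x := m)
    exact ((hi d).add ((hi e).mul hx)).add ((hi h₂).mul hy)
  · push_cast
    linear_combination hz + hd' + x * he'

end EisensteinCongruence

open EisensteinCongruence

theorem proposition8p2 (k : ℕ) (hk : 12 ≤ k) (hk' : k ≤ 46)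
    (f : CuspForm 𝒮ℒ (k : ℤ)) (hf : IsEigenform f) (n : ℕ) (hn : Odd n) :
    AlgIntModEq 128 (fourierCoeff1 f n) (ArithmeticFunction.sigma (k - 1) n : ℂ) := by
  rcases exists_weight_decomposition hk hk' hf.normalised with ⟨a, ha, rfl⟩ | ⟨a, ha, rfl⟩
  · obtain ⟨x, y, hx, hy, hxy⟩ := exists_integral_coordinates (a := a) (b := 0) (u := 8) (v := 128)
      (by omega) (by norm_num) (by omega) (by norm_num) (by norm_num)
      (basisCoeff_quadraticDvd.1 a) (basisCoeff_cubicDvd.1 a) hf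
    obtain ⟨h0, -, -, -⟩ := coeff_congruences ramanujanSystem a hn
    obtain ⟨-, -, h1, -⟩ := coeff_congruences ramanujanSystem (a - 3) hn
    simp only [pow_zero, mul_one] at hxy
    -- Here 128 = 8 · 16, with 16 from the odd coefficients of Δ² E₄^(a−3); for b = 1 it is 16 · 8.
    have := algIntModEq_of_coordinates hx hy h0 (mul_dvd_mul (dvd_refl 8) h1) (hxy n)
    rw [show 12 + 4 * a - 1 = 11 + 4 * a by omega]
    exact_mod_cast this
  · obtain ⟨x, y, hx, hy, hxy⟩ := exists_integral_coordinates (a := a) (b := 1) (u := 16) (v := 128)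
      (by omega) le_rfl (by omega) (by norm_num) (by norm_num)
      (basisCoeff_quadraticDvd.2 a) (fun h ↦ basisCoeff_cubicDvd.2 a (by grind)) hf
    obtain ⟨-, h0, -, -⟩ := coeff_congruences ramanujanSystem a hn
    obtain ⟨-, -, -, h1⟩ := coeff_congruences ramanujanSystem (a - 3) hn
    simp only [pow_one] at hxy
    have := algIntModEq_of_coordinates hx hy h0 (mul_dvd_mul (dvd_refl 16) h1) (hxy n)
    rw [show 18 + 4 * a - 1 = 17 + 4 * a by omega]
    exact_mod_cast this
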